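/- Let \textsc{Narrow Grid Tiling} be the following decision problem. An instance $(x,y,N,\mathcal S)$ consists of integers $x,y,N\ge 1$ and a collection $\mathcal S=\{S_{i,j}\}_{(i,j)\in[x]\times[y]}$ of non-empty sets $S_{i,j}\subseteq\{0,1\}\times[N]$, where $[m]=\{1,\dots,m\}$. The question is whether one can choose $s_{i,j}\in S_{i,j}$ for all $(i,j)\in[x]\times[y]$ such that $s_{i,j}$ and $s_{i+1,j}$ have the same first component whenever $1\le i<x$, $1\le j\le y$, and $s_{i,j}$ and $s_{i,j+1}$ have the same second component whenever $1\le i\le x$, $1\le j<y$. The Exponential Time Hypothesis (ETH) states that there is $\delta>0$ such that 3-SAT with $n$ variables (formulas being sets of clauses with at most three literals) cannot be solved in time $O(2^{\delta n})$. Algorithms are deterministic multi-tape Turing machines, and time is the number of steps. \textbf{Theorem.} Assume ETH. (1) For every $b>0$ there exists $\varepsilon>0$ such that for every $C>0$ there is no algorithm that solves every instance $(x,y,N,\mathcal S)$ of \textsc{Narrow Grid Tiling} in time $$C\cdot 2^{\varepsilon\,(xy+x^2\log_2 N)}\cdot N^{b}.$$ (2) In particular, there is no $2^{o(xy)}\cdot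 N^{O(1)}$ time algorithm for \textsc{Narrow Grid Tiling}: for every function $f:\mathbb N\to\mathbb R$ with $f(s)=o(s)$ as $s\to\infty$ and every real $b$, no algorithm solves every instance $(x,y,N,\mathcal S)$ in time $2^{f(xy)}\cdot N^{b}$. -/

import Mathlib

/-- The deterministic multi-stack Turing machine `M` (Mathlib's machine model, with input alphabet
`Γ` and output alphabet `Bool`) decides the problem `P` on the instances in `α`, presented to the
machine by the encoding `enc`: on every instance `a` it halts with the correct answer to
"does `P a` hold?" as its output, after at most `T a` steps. -/
def DecidesInTime {α Γ : Type} (M : Turing.TM2ComputableAux Γ Bool) (enc : α → List Γ)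
    (P : α → Prop) (T : α → ℝ) : Prop :=
  ∀ a : α, ∃ (ans : Bool) (t : ℕ), (ans = true ↔ P a) ∧ (t : ℝ) ≤ T a ∧
    Nonempty (Turing.TM2OutputsInTime M.tm
      (List.map M.inputAlphabet.invFun (enc a))
      (some (List.map M.outputAlphabet.invFun (Computability.encodeBool ans))) t)

/-- The problem `P`, with instances encoded by `enc`, can be solved by an algorithm that takes time
at most `T a` on every instance `a`. -/
def SolvableInTime {α Γ : Type} (enc : α → List Γ) (P : α → Prop) (T : α → ℝ) : Prop :=
  ∃ M : Turing.TM2ComputableAux Γ Bool, DecidesInTime M enc P T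

/-! ### 3-SAT and the Exponential Time Hypothesis -/

/-- A literal over the variables `0, …, n - 1`: a variable together with its sign
(`true` for `x`, `false` for `¬ x`). -/
abbrev Literal (n : ℕ) : Type := Fin n × Bool

/-- A 3-CNF formula with `numVars` variables. Each clause is a disjunction of three literals, which
may coincide, so that clauses with one or two distinct literals are included. A formula is
a set of clauses: no clause is listed twice. (If clauses could be repeated, the length of
the input would not be bounded in terms of the number of variables.) -/
structure ThreeCNF : Type where
  numVars : ℕ
  clauses : List (Fin 3 → Literal numVars)
  nodup : clauses.Nodup

namespace ThreeCNF

/-- Some assignment makes at least one literal of every clause true. -/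
def Satisfiable (φ : ThreeCNF) : Prop :=
  ∃ v : Fin φ.numVars → Bool, ∀ c ∈ φ.clauses, ∃ k : Fin 3, v (c k).1 = (c k).2

/-- A literal is encoded by the index of its variable in unary, a delimiter, and its sign. -/
def encodeLiteral {n : ℕ} (l : Literal n) : List Bool :=
  List.replicate l.1.val true ++ [false, l.2]

/-- The number of variables in unary and a delimiter, then the literals of all the clauses. -/
def encode (φ : ThreeCNF) : List Bool :=
  List.replicate φ.numVars true ++ [false] ++
    φ.clauses.flatMap fun c => (List.finRange 3).flatMap fun k => encodeLiteral (c k)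

end ThreeCNF

/-- The Exponential Time Hypothesis: there is `δ > 0` such that 3-SAT with `n` variables cannot be
solved in time `O(2 ^ (δ n))`. -/
def ExponentialTimeHypothesis : Prop :=
  ∃ δ : ℝ, 0 < δ ∧ ¬ ∃ C : ℝ,
    SolvableInTime ThreeCNF.encode ThreeCNF.Satisfiable
      fun φ => C * (2 : ℝ) ^ (δ * (φ.numVars : ℝ))

/-! ### Narrow Grid Tiling -/

/-- An instance of Narrow Grid Tiling: positive integers `x`, `y`, an integer `N`, and non-empty
sets `S i j ⊆ {0, 1} × [N]` for `(i, j) ∈ [x] × [y]`. (`N` is positive as well, because the sets are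
non-empty.) -/
structure NarrowGridTiling : Type where
  x : ℕ
  y : ℕ
  N : ℕ
  x_pos : 0 < x
  y_pos : 0 < y
  S : Fin x → Fin y → Finset (Bool × Fin N)
  nonempty : ∀ i j, (S i j).Nonempty

namespace NarrowGridTiling

/-- A choice of one pair per cell is consistent if each pair belongs to the set of its cell,
the pairs in the cells `(i, j)` and `(i + 1, j)` agree in the first component, and the pairs in
the cells `(i, j)` and `(i, j + 1)` agree in the second component. -/
structure Consistent (I : NarrowGridTiling) (s : Fin I.x → Fin I.y → Bool × Fin I.N) : Prop where
  mem : ∀ i j, s i j ∈ I.S i j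
  vertical : ∀ (i i' : Fin I.x) (j : Fin I.y), (i' : ℕ) = (i : ℕ) + 1 → (s i j).1 = (s i' j).1
  horizontal : ∀ (i : Fin I.x) (j j' : Fin I.y), (j' : ℕ) = (j : ℕ) + 1 → (s i j).2 = (s i j').2

/-- `I` is a yes-instance. -/
def IsYes (I : NarrowGridTiling) : Prop :=
  ∃ s, I.Consistent s

/-- The numbers `x`, `y`, `N` in unary, each followed by a delimiter, then for each cell, row
by row, the table of the `2 N` bits that tell which pairs belong to the set of that cell. -/
def encode (I : NarrowGridTiling) : List Bool :=
  List.replicate I.x true ++ [false] ++ List.replicate I.y true ++ [false] ++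
    List.replicate I.N true ++ [false] ++
    (List.finRange I.x).flatMap fun i => (List.finRange I.y).flatMap fun j =>
      [false, true].flatMap fun a => (List.finRange I.N).map fun v => decide ((a, v) ∈ I.S i j)

end NarrowGridTiling


/-!
Split the variables of a 3-CNF formula with `n` variables into `k` residue classes modulo `k`, for a
large constant `k`. The tiling instance has one row for each triple of classes; a second component
chosen in this row, which propagates along the whole row, is the number of an assignment of the at
most `3 (n / k + 1)` variables of the triple. The first components of column `j < n` hold the truth
value of the variable `j`, so that all rows which assign this variable agree on it, and the last
column only admits assignments that satisfy all clauses inside their domain. Every clause lies in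
some triple of classes, so the instance is equivalent to the formula.

Here `x = k ^ 3` is constant, `y = n + 1` and `log N = 3 n / k + O(1)`. Hence `x y + x² log N` is
`O(n)` with a constant that depends on `k` only, and `N ^ b` is at most a constant times
`2 ^ (3 b n / k)`. Choosing first `k` large and then `ε` small turns a fast algorithm for the tiling
problem into one for 3-SAT with time `O(2 ^ (δ n))`, provided that the reduction is as fast. For
this, the numbering of the assignments of a triple is the one by binary numbers: a machine can then
enumerate them by incrementing a binary counter, whose digits are the entries of the current
assignment, and test each of them against the formula.

The second part follows, since `2 ^ f s` is at most a constant times `2 ^ (ε s)` if `f s = o(s)`.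
-/

open Function Turing StateTransition

/-! ### Bounded reachability -/

/-- The transition function `f` leads from `a` to `b` in at most `t` steps. -/
def ReachesInTime {σ : Type*} (f : σ → Option σ) (a b : σ) (t : ℕ) : Prop :=
  Nonempty (EvalsToInTime f a (some b) t)

namespace ReachesInTime

variable {σ τ : Type*} {f : σ → Option σ} {g : τ → Option τ} {a b c : σ} {s t : ℕ}

theorem refl (f : σ → Option σ) (a : σ) : ReachesInTime f a a 0 :=
  ⟨EvalsToInTime.refl f a⟩

theorem single (h : f a = some b) : ReachesInTime f a b 1 :=
  ⟨⟨⟨1, h⟩, le_rfl⟩⟩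

theorem trans (hab : ReachesInTime f a b s) (hbc : ReachesInTime f b c t) :
    ReachesInTime f a c (s + t) := by
  obtain ⟨hab⟩ := hab
  obtain ⟨hbc⟩ := hbc
  rw [add_comm]
  exact ⟨EvalsToInTime.trans _ _ _ _ _ _ hab hbc⟩

theorem mono (h : ReachesInTime f a b s) (hst : s ≤ t) : ReachesInTime f a b t := by
  obtain ⟨h⟩ := h
  exact ⟨⟨h.toEvalsTo, h.steps_le_m.trans hst⟩⟩

theorem map (φ : σ → τ) (hφ : ∀ a, g (φ a) = (f a).map φ) (h : ReachesInTime f a b t) :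
    ReachesInTime g (φ a) (φ b) t := by
  obtain ⟨h⟩ := h
  have hsemi : Semiconj (Option.map φ) (flip bind f) (flip bind g) := by
    rintro (_ | a)
    · rfl
    · exact (hφ a).symm
  refine ⟨⟨⟨h.steps, ?_⟩, h.steps_le_m⟩⟩
  exact ((hsemi.iterate_right h.steps (some a)).symm).trans (congrArg _ h.evals_in_steps)

end ReachesInTime

/-! ### Structured stack programs -/

/-- Structured programs over stacks of bits indexed by `K`. `pop k P` pops the stack `k` and goes on
with the branch for the symbol found; `loop k c P` pops `k`, and if the symbol found passes the
test `c` it executes the branch for it and starts over. -/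
inductive StackProg (K : Type) : Type
  | skip : StackProg K
  | push (k : K) (b : Bool) : StackProg K
  | seq (P Q : StackProg K) : StackProg K
  | pop (k : K) (P : Option Bool → StackProg K) : StackProg K
  | loop (k : K) (c : Option Bool → Bool) (P : Option Bool → StackProg K) : StackProg K

namespace StackProg

infixr:65 " ;; " => StackProg.seq

variable {K : Type}

/-- The labels that occur in a program, with the label of a `pop` or `loop` instruction itself
represented by `none`. -/
def Label : StackProg K → Type
  | skip => Empty
  | push _ _ => Unit
  | seq P Q => P.Label ⊕ Q.Label
  | pop _ P => Option (Σ o, (P o).Label)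
  | loop _ _ P => Option (Σ o, (P o).Label)

instance finite_label (P : StackProg K) : Finite P.Label := by
  induction P with
  | skip => exact inferInstanceAs (Finite Empty)
  | push => exact inferInstanceAs (Finite Unit)
  | seq P Q _ _ => exact inferInstanceAs (Finite (P.Label ⊕ Q.Label))
  | pop _ P _ => exact inferInstanceAs (Finite (Option (Σ o, (P o).Label)))
  | loop _ _ P _ => exact inferInstanceAs (Finite (Option (Σ o, (P o).Label)))

/-- The label at which the execution of a program starts, if its labels are embedded by `e` and it
is left through the label `x`. -/
def entry {Λ : Type} : (P : StackProg K) → (P.Label → Λ) → Λ → Λ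
  | skip, _, x => x
  | push _ _, e, _ => e ()
  | seq P Q, e, x => P.entry (fun l => e (Sum.inl l)) (Q.entry (fun l => e (Sum.inr l)) x)
  | pop _ _, e, _ => e none
  | loop _ _ _, e, _ => e none

/-- The stack alphabets of a machine that has the stacks of bits of a program and further stacks. -/
abbrev Alphabet (K : Type) {K' : Type} (Γ : K' → Type) : K ⊕ K' → Type :=
  Sum.elim (fun _ => Bool) Γ

section Compile

variable {K' : Type} {Γ : K' → Type} {Λ σ : Type}

/-- The instructions of a program for a machine with further stacks and a further component of its
internal state. The symbol popped last is kept in the first component of the state. -/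
def code : (P : StackProg K) → (P.Label → Λ) → Λ → P.Label →
    TM2.Stmt (Alphabet K Γ) Λ (Option Bool × σ)
  | skip, _, _, l => nomatch (show Empty from l)
  | push k b, _, x, _ => .push (Sum.inl k) (fun _ => b) (.goto fun _ => x)
  | seq P Q, e, x, Sum.inl l =>
    P.code (fun l => e (Sum.inl l)) (Q.entry (fun l => e (Sum.inr l)) x) l
  | seq _ Q, e, x, Sum.inr l => Q.code (fun l => e (Sum.inr l)) x l
  | pop k P, e, x, none => .pop (Sum.inl k) (fun s o => (o, s.2))
      (.goto fun s => (P s.1).entry (fun l => e (some ⟨s.1, l⟩)) x)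
  | pop _ P, e, x, some ⟨o, l⟩ => (P o).code (fun l => e (some ⟨o, l⟩)) x l
  | loop k c P, e, x, none => .pop (Sum.inl k) (fun s o => (o, s.2))
      (.goto fun s => bif c s.1 then (P s.1).entry (fun l => e (some ⟨s.1, l⟩)) (e none) else x)
  | loop _ _ P, e, _, some ⟨o, l⟩ => (P o).code (fun l => e (some ⟨o, l⟩)) (e none) l

variable [DecidableEq K] [DecidableEq K']

/-- `Run P S t S'`: started with the stacks `S`, the program `P` ends with the stacks `S'` after at
most `t` steps. -/
inductive Run : StackProg K → (K → List Bool) → ℕ → (K → List Bool) → Prop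
  | skip (S) : Run skip S 0 S
  | push (S k b) : Run (push k b) S 1 (update S k (b :: S k))
  | seq {P Q S S₁ S₂ t₁ t₂} : Run P S t₁ S₁ → Run Q S₁ t₂ S₂ → Run (P ;; Q) S (t₁ + t₂) S₂
  | pop {k P S S' t} : Run (P (S k).head?) (update S k (S k).tail) t S' →
      Run (pop k P) S (t + 1) S'
  | loop_exit {k c P S} : c (S k).head? = false → Run (loop k c P) S 1 (update S k (S k).tail)
  | loop_next {k c P S S₁ S₂ t₁ t₂} : c (S k).head? = true →
      Run (P (S k).head?) (update S k (S k).tail) t₁ S₁ → Run (loop k c P) S₁ t₂ S₂ →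
      Run (loop k c P) S (t₁ + t₂ + 1) S₂
  | mono {P S S' t t'} : Run P S t S' → t ≤ t' → Run P S t' S'

/-- The contents of the stacks of bits of a program together with those of further stacks. -/
def joinStacks (S : K → List Bool) (T : ∀ k, List (Γ k)) (k : K ⊕ K') : List (Alphabet K Γ k) :=
  Sum.rec S T k

theorem update_joinStacks_inl (S : K → List Bool) (T : ∀ k, List (Γ k)) (k : K) (l : List Bool) :
    update (joinStacks S T) (Sum.inl k) l = joinStacks (update S k l) T :=
  (Sum.rec_update_left (γ := fun k => List (Alphabet K Γ k)) S T k l).symm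

theorem update_joinStacks_inr (S : K → List Bool) (T : ∀ k, List (Γ k)) (k : K') (l : List (Γ k)) :
    update (joinStacks S T) (Sum.inr k) l = joinStacks S (update T k l) :=
  (Sum.rec_update_right (γ := fun k => List (Alphabet K Γ k)) S T k l).symm

theorem stepAux_pop_inl (S : K → List Bool) (T : ∀ k, List (Γ k)) (k : K)
    (f : σ → Option Bool → σ) (q : TM2.Stmt (Alphabet K Γ) Λ σ) (v : σ) :
    TM2.stepAux (.pop (Sum.inl k) f q) v (joinStacks S T) =
      TM2.stepAux q (f v (S k).head?) (joinStacks (update S k (S k).tail) T) :=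
  congrArg (TM2.stepAux q _) (update_joinStacks_inl S T k _)

theorem stepAux_push_inr (S : K → List Bool) (T : ∀ k, List (Γ k)) (k : K')
    (f : σ → Γ k) (q : TM2.Stmt (Alphabet K Γ) Λ σ) (v : σ) :
    TM2.stepAux (.push (Sum.inr k) f q) v (joinStacks S T) =
      TM2.stepAux q v (joinStacks S (update T k (f v :: T k))) :=
  congrArg (TM2.stepAux q v) (update_joinStacks_inr S T k _)

theorem reachesInTime_one {m : Λ → TM2.Stmt (Alphabet K Γ) Λ σ} {l : Λ}
    {q : TM2.Stmt (Alphabet K Γ) Λ σ} {v : σ} {S : ∀ k, List (Alphabet K Γ k)}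
    {c : TM2.Cfg (Alphabet K Γ) Λ σ} (hq : m l = q) (h : TM2.stepAux q v S = c) :
    ReachesInTime (TM2.step m) ⟨some l, v, S⟩ c 1 :=
  .single (by subst hq h; rfl)

theorem Run.reachesInTime {P : StackProg K} {S S' : K → List Bool} {t : ℕ} (h : Run P S t S')
    (m : Λ → TM2.Stmt (Alphabet K Γ) Λ (Option Bool × σ)) (T : ∀ k, List (Γ k)) (s : σ)
    (e : P.Label → Λ) (x : Λ) (hm : ∀ l, m (e l) = P.code e x l) (r : Option Bool) :
    ∃ r', ReachesInTime (TM2.step m) ⟨some (P.entry e x), (r, s), joinStacks S T⟩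
      ⟨some x, (r', s), joinStacks S' T⟩ t := by
  induction h generalizing x r with
  | skip S => exact ⟨r, .refl _ _⟩
  | push S k b =>
    exact ⟨r, reachesInTime_one (hm ())
      (congrArg (TM2.stepAux (.goto fun _ => x) (r, s)) (update_joinStacks_inl S T k _))⟩
  | seq _ _ ih₁ ih₂ =>
    obtain ⟨r₁, h₁⟩ := ih₁ (fun l => e (Sum.inl l)) _ (fun l => hm (Sum.inl l)) r
    obtain ⟨r₂, h₂⟩ := ih₂ (fun l => e (Sum.inr l)) _ (fun l => hm (Sum.inr l)) r₁
    exact ⟨r₂, h₁.trans h₂⟩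
  | @pop k P S S' t _ ih =>
    obtain ⟨r', h⟩ := ih (fun l => e (some ⟨_, l⟩)) x (fun l => hm (some ⟨_, l⟩)) (S k).head?
    have hpop := reachesInTime_one (hm none) (stepAux_pop_inl S T k _ _ (r, s))
    exact ⟨r', (hpop.trans h).mono (add_comm _ _).le⟩
  | @loop_exit k c P S hc =>
    refine ⟨(S k).head?, reachesInTime_one (hm none) ((stepAux_pop_inl S T k _ _ _).trans ?_)⟩
    simp only [TM2.stepAux, hc, cond_false]
  | @loop_next k c P S S₁ S₂ t₁ t₂ hc _ _ ih₁ ih₂ =>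
    obtain ⟨r₁, h₁⟩ := ih₁ (fun l => e (some ⟨_, l⟩)) (e none) (fun l => hm (some ⟨_, l⟩))
      (S k).head?
    obtain ⟨r₂, h₂⟩ := ih₂ e x hm r₁
    have hpop : ReachesInTime (TM2.step m) ⟨some (e none), (r, s), joinStacks S T⟩
        ⟨some ((P (S k).head?).entry (fun l => e (some ⟨(S k).head?, l⟩)) (e none)),
          ((S k).head?, s), joinStacks (update S k (S k).tail) T⟩ 1 := by
      refine reachesInTime_one (hm none) ((stepAux_pop_inl S T k _ _ _).trans ?_)
      simp only [TM2.stepAux, hc, cond_true]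
    exact ⟨r₂, (hpop.trans (h₁.trans h₂)).mono (add_comm _ _).le⟩
  | mono _ hle ih =>
    obtain ⟨r', h⟩ := ih e x hm r
    exact ⟨r', h.mono hle⟩

end Compile

/-! ### Reductions computed by stack programs -/

section Precompose

variable [DecidableEq K] (M : FinTM2)

/-- A statement of `M` as a statement of a machine that has further stacks and a further component
of its internal state. -/
def liftStmt {Λ : Type} : TM2.Stmt M.Γ M.Λ M.σ →
    TM2.Stmt (Alphabet K M.Γ) (Λ ⊕ M.Λ) (Option Bool × M.σ)
  | .push k f q => .push (Sum.inr k) (fun s => f s.2) (liftStmt q)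
  | .peek k f q => .peek (Sum.inr k) (fun s o => (s.1, f s.2 o)) (liftStmt q)
  | .pop k f q => .pop (Sum.inr k) (fun s o => (s.1, f s.2 o)) (liftStmt q)
  | .load f q => .load (fun s => (s.1, f s.2)) (liftStmt q)
  | .branch f q₁ q₂ => .branch (fun s => f s.2) (liftStmt q₁) (liftStmt q₂)
  | .goto f => .goto fun s => Sum.inr (f s.2)
  | .halt => .halt

/-- A configuration of `M` as a configuration of the larger machine whose further stacks are
empty. -/
def liftCfg {Λ : Type} (c : TM2.Cfg M.Γ M.Λ M.σ) :
    TM2.Cfg (Alphabet K M.Γ) (Λ ⊕ M.Λ) (Option Bool × M.σ) :=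
  ⟨c.l.map Sum.inr, (none, c.var), joinStacks (fun _ => []) c.stk⟩

theorem stepAux_liftStmt {Λ : Type} (q : TM2.Stmt M.Γ M.Λ M.σ) (v : M.σ)
    (T : ∀ k, List (M.Γ k)) :
    TM2.stepAux (liftStmt (K := K) (Λ := Λ) M q) (none, v) (joinStacks (fun _ => []) T) =
      liftCfg M (TM2.stepAux q v T) := by
  induction q generalizing v T with
  | push k f q ih => exact (stepAux_push_inr _ T k _ _ _).trans (ih _ _)
  | peek _ _ _ ih => exact ih _ _
  | pop k f q ih =>
    exact (congrArg (TM2.stepAux _ _) (update_joinStacks_inr _ T k _)).trans (ih _ _)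
  | load _ _ ih => exact ih _ _
  | branch f q₁ q₂ ih₁ ih₂ =>
    simp only [liftStmt, TM2.stepAux]
    cases f v
    · exact ih₂ _ _
    · exact ih₁ _ _
  | goto f => rfl
  | halt => rfl

theorem step_liftCfg {Λ : Type}
    {m : Λ ⊕ M.Λ → TM2.Stmt (Alphabet K M.Γ) (Λ ⊕ M.Λ) (Option Bool × M.σ)}
    (hm : ∀ l, m (Sum.inr l) = liftStmt M (M.m l)) (c : TM2.Cfg M.Γ M.Λ M.σ) :
    TM2.step m (liftCfg M c) = (TM2.step M.m c).map (liftCfg M) := by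
  obtain ⟨_ | l, v, T⟩ := c
  · rfl
  · change some (TM2.stepAux (m (Sum.inr l)) (none, v) (joinStacks (fun _ => []) T)) = _
    rw [hm, stepAux_liftStmt]
    rfl

theorem initList_eq (w : List (M.Γ M.k₀)) :
    initList M w = ⟨some M.main, M.initialState, update (fun _ => []) M.k₀ w⟩ := by
  refine congrArg (TM2.Cfg.mk _ _) (funext fun k => ?_)
  by_cases h : k = M.k₀
  · subst h
    simp
  · simp [h]

theorem haltList_eq (w : List (M.Γ M.k₁)) :
    haltList M w = ⟨none, M.initialState, update (fun _ => []) M.k₁ w⟩ := by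
  refine congrArg (TM2.Cfg.mk _ _) (funext fun k => ?_)
  by_cases h : k = M.k₁
  · subst h
    simp
  · simp [h]

variable [Fintype K] (P : StackProg K) (inp out : K) (toInput : Bool → M.Γ M.k₀)

/-- The statement that moves a symbol of the stack `out` to the input stack of `M`, or starts `M` if
there is none. -/
def transferStmt : TM2.Stmt (Alphabet K M.Γ) (Option P.Label ⊕ M.Λ) (Option Bool × M.σ) :=
  .pop (Sum.inl out) (fun s o => (o, s.2))
    (.branch (fun s => s.1.isSome)
      (.push (Sum.inr M.k₀) (fun s => toInput (s.1.getD false)) (.goto fun _ => Sum.inl none))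
      (.goto fun _ => Sum.inr M.main))

/-- The machine that executes the program `P`, moves the contents of the stack `out` to the
input stack of `M`, and then behaves like `M`. -/
noncomputable def precompose : FinTM2 where
  K := K ⊕ M.K
  kFin := letI := M.kFin; inferInstance
  k₀ := Sum.inl inp
  k₁ := Sum.inr M.k₁
  Γ := Alphabet K M.Γ
  Λ := Option P.Label ⊕ M.Λ
  main := P.entry (fun l => Sum.inl (some l)) (Sum.inl none)
  ΛFin := letI := M.ΛFin; Fintype.ofFinite _
  σ := Option Bool × M.σ
  initialState := (none, M.initialState)
  σFin := letI := M.σFin; inferInstance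
  Γk₀Fin := inferInstanceAs (Fintype Bool)
  m
    | Sum.inl (some l) => P.code (fun l => Sum.inl (some l)) (Sum.inl none) l
    | Sum.inl none => transferStmt M P out toInput
    | Sum.inr l => liftStmt M (M.m l)

theorem initList_precompose (w : List Bool) :
    initList (precompose M P inp out toInput) w =
      ⟨some (P.entry (fun l => Sum.inl (some l)) (Sum.inl none)), (none, M.initialState),
        joinStacks (update (fun _ => []) inp w) fun _ => []⟩ := by
  refine (initList_eq (precompose M P inp out toInput) w).trans (congrArg (TM2.Cfg.mk _ _) ?_)
  rw [← update_joinStacks_inl]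
  congr 1
  funext k
  cases k <;> rfl

theorem haltList_precompose (o : List (M.Γ M.k₁)) :
    haltList (precompose M P inp out toInput) o = liftCfg M (haltList M o) := by
  rw [haltList_eq]
  refine (haltList_eq (precompose M P inp out toInput) o).trans (congrArg (TM2.Cfg.mk _ _) ?_)
  rw [← update_joinStacks_inr]
  congr 1
  funext k
  cases k <;> rfl

theorem transfer_reachesInTime (w : List Bool) (T : ∀ k, List (M.Γ k)) (r : Option Bool) (s : M.σ) :
    ReachesInTime (TM2.step (precompose M P inp out toInput).m)
      ⟨some (Sum.inl none), (r, s), joinStacks (update (fun _ => []) out w) T⟩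
      ⟨some (Sum.inr M.main), (none, s), joinStacks (fun _ => [])
        (update T M.k₀ ((w.map toInput).reverse ++ T M.k₀))⟩ (w.length + 1) := by
  induction w generalizing T r with
  | nil =>
    refine reachesInTime_one (q := transferStmt M P out toInput) rfl
      ((stepAux_pop_inl _ T out _ _ (r, s)).trans ?_)
    simp only [TM2.stepAux, update_self, update_eq_self, List.head?_nil, List.tail_nil,
      Option.isSome_none, cond_false, List.map_nil, List.reverse_nil, List.nil_append]
    rfl
  | cons b w ih =>
    have hmove : ReachesInTime (TM2.step (precompose M P inp out toInput).m)
        ⟨some (Sum.inl none), (r, s), joinStacks (update (fun _ => []) out (b :: w)) T⟩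
        ⟨some (Sum.inl none), (some b, s), joinStacks (update (fun _ => []) out w)
          (update T M.k₀ (toInput b :: T M.k₀))⟩ 1 := by
      refine reachesInTime_one (q := transferStmt M P out toInput) rfl
        ((stepAux_pop_inl _ T out _ _ (r, s)).trans ?_)
      rw [update_self, update_idem]
      exact stepAux_push_inr _ T M.k₀ (fun s : Option Bool × M.σ => toInput (s.1.getD false))
        (.goto fun _ => Sum.inl none) (some b, s)
    have := hmove.trans (ih (update T M.k₀ (toInput b :: T M.k₀)) (some b))
    rw [update_self, update_idem] at this
    simpa [add_comm] using this

theorem precompose_outputsInTime {w v : List Bool} {t₁ t₂ : ℕ} {o : List (M.Γ M.k₁)}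
    (hP : Run P (update (fun _ => []) inp w) t₁ (update (fun _ => []) out v.reverse))
    (hM : Nonempty (TM2OutputsInTime M (v.map toInput) (some o) t₂)) :
    Nonempty (TM2OutputsInTime (precompose M P inp out toInput) w (some o)
      (t₁ + (v.length + 1) + t₂)) := by
  obtain ⟨r, hrun⟩ := hP.reachesInTime (precompose M P inp out toInput).m (fun _ => [])
    M.initialState (fun l => Sum.inl (some l)) (Sum.inl none) (fun _ => rfl) none
  have htransfer :=
    transfer_reachesInTime M P inp out toInput v.reverse (fun _ => []) r M.initialState
  have hlift : ReachesInTime (TM2.step (precompose M P inp out toInput).m)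
      (liftCfg M (initList M (v.map toInput))) (liftCfg M (haltList M o)) t₂ :=
    ReachesInTime.map _ (step_liftCfg M fun _ => rfl) hM
  rw [initList_eq] at hlift
  rw [List.map_reverse, List.reverse_reverse, List.append_nil, List.length_reverse] at htransfer
  have := (hrun.trans htransfer).trans hlift
  rw [← haltList_precompose M P inp out toInput] at this
  change ReachesInTime _ (initList (precompose M P inp out toInput) w) _ _
  rw [initList_precompose]
  exact this

end Precompose

end StackProg

namespace SolvableInTime

open StackProg in
theorem of_reduction {α β : Type} {encA : α → List Bool} {encB : β → List Bool}
    {P : α → Prop} {Q : β → Prop} {T : β → ℝ} (hQ : SolvableInTime encB Q T) (f : α → β)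
    (hf : ∀ a, Q (f a) ↔ P a) {K : Type} [DecidableEq K] [Finite K] (R : StackProg K)
    (inp out : K) (t : α → ℕ)
    (hR : ∀ a, Run R (update (fun _ => []) inp (encA a)) (t a)
      (update (fun _ => []) out (encB (f a)).reverse)) :
    SolvableInTime encA P fun a => T (f a) + (t a + (encB (f a)).length + 1 : ℕ) := by
  obtain ⟨M, hM⟩ := hQ
  have := Fintype.ofFinite K
  refine ⟨⟨precompose M.tm R inp out M.inputAlphabet.invFun, Equiv.refl Bool, M.outputAlphabet⟩,
    fun a => ?_⟩
  obtain ⟨ans, s, hans, hs, hout⟩ := hM (f a)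
  refine ⟨ans, t a + ((encB (f a)).length + 1) + s, hans.trans (hf a), ?_,
    precompose_outputsInTime M.tm R inp out M.inputAlphabet.invFun (w := List.map id (encA a))
      (o := List.map _ _) ?_ hout⟩
  · push_cast
    linarith
  · rw [List.map_id]
    exact hR a

theorem mono {α Γ : Type} {enc : α → List Γ} {P : α → Prop} {T T' : α → ℝ}
    (h : SolvableInTime enc P T) (hT : ∀ a, T a ≤ T' a) : SolvableInTime enc P T' := by
  obtain ⟨M, hM⟩ := h
  refine ⟨M, fun a => ?_⟩
  obtain ⟨ans, t, hans, ht, hout⟩ := hM a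
  exact ⟨ans, t, hans, ht.trans (hT a), hout⟩

end SolvableInTime

namespace StackProg

variable {K : Type}

/-- Pushes a symbol if there is one. -/
def pushOpt (k : K) (o : Option Bool) : StackProg K :=
  o.elim skip (push k)

/-- Pushes the symbols of a list, one after the other. -/
def pushList (k : K) (l : List Bool) : StackProg K :=
  l.foldr (fun b P => push k b ;; P) skip

/-- Empties a stack. -/
def clear (k : K) : StackProg K :=
  loop k Option.isSome fun _ => skip

/-- Moves the contents of the stack `k` to the stack `k'`. -/
def moveAll (k k' : K) : StackProg K :=
  loop k Option.isSome (pushOpt k')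

/-- Executes `B` once for each symbol of the stack `k`, which meanwhile are parked on `k'`. The
stack `k` is meant to hold a number in unary. -/
def forUnary (k k' : K) (B : StackProg K) : StackProg K :=
  loop k Option.isSome (fun _ => push k' true ;; B) ;; moveAll k' k

variable [DecidableEq K]

namespace Run

theorem cast {P : StackProg K} {S S₁ S₂ : K → List Bool} {t t' : ℕ} (h : Run P S t S₁)
    (hS : S₁ = S₂) (ht : t ≤ t') : Run P S t' S₂ := by
  subst hS
  exact h.mono ht

theorem pushList (S : K → List Bool) (k : K) (l : List Bool) :
    Run (StackProg.pushList k l) S l.length (update S k (l.reverse ++ S k)) := by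
  induction l generalizing S with
  | nil => exact (Run.skip S).cast (by simp) le_rfl
  | cons b l ih =>
    exact (Run.seq (.push S k b) (ih _)).cast (by simp) (by simp [add_comm])

theorem clear (S : K → List Bool) (k : K) :
    Run (StackProg.clear k) S ((S k).length + 1) (update S k []) := by
  obtain ⟨l, hl⟩ : ∃ l, S k = l := ⟨_, rfl⟩
  induction l generalizing S with
  | nil => exact (Run.loop_exit (by simp [hl])).cast (by simp [hl]) (by simp)
  | cons b l ih =>
    exact (Run.loop_next (by simp [hl]) (.skip _) (ih _ (by simp [hl]))).cast (by simp)
      (by simp [hl])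

theorem moveAll (S : K → List Bool) {k k' : K} (hk : k ≠ k') :
    Run (StackProg.moveAll k k') S (2 * (S k).length + 1)
      (update (update S k []) k' ((S k).reverse ++ S k')) := by
  obtain ⟨l, hl⟩ : ∃ l, S k = l := ⟨_, rfl⟩
  induction l generalizing S with
  | nil =>
    refine (Run.loop_exit (by simp [hl])).cast ?_ (by simp)
    simp [hl, update_comm hk]
  | cons b l ih =>
    have hpush : Run (pushOpt k' (S k).head?) (update S k (S k).tail) 1
        (update (update S k l) k' (b :: S k')) := by
      rw [hl]
      exact (Run.push _ _ _).cast (by simp [hk.symm]) le_rfl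
    refine (Run.loop_next (by simp [hl]) hpush (ih _ (by simp [hk]))).cast ?_ ?_
    · simp [hk, hl, update_comm hk]
    · simp only [update_of_ne hk, update_self, hl, List.length_cons]
      omega

theorem forUnary {k k' : K} (hk : k ≠ k') {B : StackProg K} {F : ℕ → K → List Bool} {n t : ℕ}
    (hB : ∀ m < n, ∀ l l', Run B (update (update (F m) k l) k' l') t
      (update (update (F (m + 1)) k l) k' l')) :
    Run (StackProg.forUnary k k' B)
      (update (update (F 0) k (List.replicate n true)) k' []) (n * (t + 4) + 2)
      (update (update (F n) k (List.replicate n true)) k' []) := by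
  have hloop : ∀ d m, m + d = n →
      Run (StackProg.loop k Option.isSome (fun _ => StackProg.push k' true ;; B))
        (update (update (F m) k (List.replicate d true)) k' (List.replicate m true))
        (d * (t + 2) + 1) (update (update (F n) k []) k' (List.replicate n true)) := by
    intro d
    induction d with
    | zero =>
      rintro m rfl
      exact (Run.loop_exit (by simp [hk])).cast (by simp [hk, update_comm hk]) (by simp)
    | succ d ih =>
      intro m hm
      have hbody : Run (StackProg.push k' true ;; B)
          (update (update (F m) k (List.replicate d true)) k' (List.replicate m true)) (1 + t)
          (update (update (F (m + 1)) k (List.replicate d true)) k'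
            (List.replicate (m + 1) true)) :=
        Run.seq (.push _ _ _) (by simpa [List.replicate_succ] using hB m (by omega) _ _)
      refine (Run.loop_next (by simp [hk, List.replicate_succ]) (t₁ := 1 + t) ?_
        (ih (m + 1) (by omega))).cast rfl (by ring_nf; omega)
      simpa [hk, update_comm hk, List.replicate_succ] using hbody
  refine (Run.seq (hloop n 0 (by omega)) (.moveAll _ hk.symm)).cast ?_ ?_
  · simp [hk, update_comm hk]
  · simp only [update_self, List.length_replicate]
    ring_nf
    omega

end Run

end StackProg

/-! ### The stacks of the reduction -/

/-- The stacks of the program that computes the reduction. Each of the stacks `inp` (the clauses),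
`ctr` (the number of variables), `num` (the number of values of a row) and `asg` (a partial
assignment) comes with a second one, on which its contents are parked while it is read. -/
inductive Stk : Type
  | inp | inpDone | ctr | ctrDone | num | numDone | asg | asgDone | res | out
  deriving DecidableEq

instance : Fintype Stk where
  elems := {.inp, .inpDone, .ctr, .ctrDone, .num, .numDone, .asg, .asgDone, .res, .out}
  complete k := by cases k <;> decide

/-- The contents of the stacks. -/
structure Store : Type where
  inp : List Bool := []
  inpDone : List Bool := []
  ctr : List Bool := []
  ctrDone : List Bool := []
  num : List Bool := []
  numDone : List Bool := []
  asg : List Bool := []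
  asgDone : List Bool := []
  res : List Bool := []
  out : List Bool := []

namespace Store

/-- The contents of a stack. -/
def get (s : Store) : Stk → List Bool
  | .inp => s.inp
  | .inpDone => s.inpDone
  | .ctr => s.ctr
  | .ctrDone => s.ctrDone
  | .num => s.num
  | .numDone => s.numDone
  | .asg => s.asg
  | .asgDone => s.asgDone
  | .res => s.res
  | .out => s.out

/-- Replaces the contents of a stack. -/
def set (s : Store) (k : Stk) (l : List Bool) : Store :=
  match k with
  | .inp => { s with inp := l }
  | .inpDone => { s with inpDone := l }
  | .ctr => { s with ctr := l }
  | .ctrDone => { s with ctrDone := l }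
  | .num => { s with num := l }
  | .numDone => { s with numDone := l }
  | .asg => { s with asg := l }
  | .asgDone => { s with asgDone := l }
  | .res => { s with res := l }
  | .out => { s with out := l }

theorem get_set (s : Store) (k : Stk) (l : List Bool) : (s.set k l).get = update s.get k l := by
  funext k'
  cases k <;> cases k' <;> rfl

end Store

open StackProg

/-- `Exec P s t s'`: started with the store `s`, the program `P` ends with the store `s'` after at
most `t` steps. -/
def Exec (P : StackProg Stk) (s : Store) (t : ℕ) (s' : Store) : Prop :=
  Run P s.get t s'.get

namespace Exec

variable {P Q : StackProg Stk} {R : Option Bool → StackProg Stk} {c : Option Bool → Bool}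
  {k k' : Stk} {l : List Bool} {s s₁ s₂ : Store} {t t₁ t₂ : ℕ}

theorem cast (h : Exec P s t s₁) (hs : s₁ = s₂) (ht : t ≤ t₂) : Exec P s t₂ s₂ :=
  Run.cast h (congrArg Store.get hs) ht

theorem cast_left (h : Exec P s₁ t s₂) (hs : s = s₁) : Exec P s t s₂ :=
  hs ▸ h

theorem skip (s : Store) : Exec skip s 0 s :=
  Run.skip _

theorem push (s : Store) (k : Stk) (b : Bool) : Exec (push k b) s 1 (s.set k (b :: s.get k)) := by
  simpa only [Exec, Store.get_set] using Run.push s.get k b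

theorem seq (h₁ : Exec P s t₁ s₁) (h₂ : Exec Q s₁ t₂ s₂) : Exec (P ;; Q) s (t₁ + t₂) s₂ :=
  Run.seq h₁ h₂

theorem pop (hl : s.get k = l) (h : Exec (R l.head?) (s.set k l.tail) t s₁) :
    Exec (pop k R) s (t + 1) s₁ := by
  subst hl
  exact Run.pop (by simpa only [Exec, Store.get_set] using h)

theorem loop_exit (hl : s.get k = l) (hc : c l.head? = false) :
    Exec (loop k c R) s 1 (s.set k l.tail) := by
  subst hl
  simpa only [Exec, Store.get_set] using Run.loop_exit hc

theorem loop_next (hl : s.get k = l) (hc : c l.head? = true)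
    (h₁ : Exec (R l.head?) (s.set k l.tail) t₁ s₁) (h₂ : Exec (loop k c R) s₁ t₂ s₂) :
    Exec (loop k c R) s (t₁ + t₂ + 1) s₂ := by
  subst hl
  exact Run.loop_next hc (by simpa only [Exec, Store.get_set] using h₁) h₂

theorem pushList (s : Store) (k : Stk) (l : List Bool) :
    Exec (pushList k l) s l.length (s.set k (l.reverse ++ s.get k)) := by
  simpa only [Exec, Store.get_set] using Run.pushList s.get k l

theorem clear (s : Store) (k : Stk) : Exec (clear k) s ((s.get k).length + 1) (s.set k []) := by
  simpa only [Exec, Store.get_set] using Run.clear s.get k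

theorem moveAll (s : Store) (hk : k ≠ k') : Exec (moveAll k k') s (2 * (s.get k).length + 1)
    ((s.set k []).set k' ((s.get k).reverse ++ s.get k')) := by
  simpa only [Exec, Store.get_set] using Run.moveAll s.get hk

theorem forUnary (hk : k ≠ k') {B : StackProg Stk} {F : ℕ → Store} {n : ℕ}
    (hs : s = ((F 0).set k (List.replicate n true)).set k' [])
    (hB : ∀ m < n, ∀ l l', Exec B (((F m).set k l).set k' l') t
      (((F (m + 1)).set k l).set k' l')) :
    Exec (forUnary k k' B) s (n * (t + 4) + 2)
      (((F n).set k (List.replicate n true)).set k' []) := by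
  subst hs
  simp only [Exec, Store.get_set] at hB ⊢
  exact Run.forUnary hk hB

end Exec

/-! ### Partial assignments -/

/-- A partial assignment of truth values to the variables `0, 1, …`: the entry of a variable
without a value is `none`. -/
abbrev PartialAssignment : Type := List (Option Bool)

namespace PartialAssignment

/-- Whether a partial assignment can be extended to one that gives the variable `j` the
value `b`. -/
def allows (w : PartialAssignment) (j : ℕ) (b : Bool) : Bool :=
  (w.getD j none).all (· == b)

/-- Adds a carry to the binary number whose digits, the least significant one first, are the values
of a partial assignment. The carry out of the most significant digit is lost. -/
def increment (carry : Bool) : PartialAssignment → PartialAssignment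
  | [] => []
  | none :: w => none :: increment carry w
  | some b :: w => some (b ^^ carry) :: increment (b && carry) w

/-- The cyclic successor among the partial assignments with the same domain. -/
def next : PartialAssignment → PartialAssignment :=
  increment true

/-- The representation of an entry on a stack: whether it allows `true`, whether it allows
`false`. -/
def entryBits (o : Option Bool) : List Bool :=
  [o.all (· == true), o.all (· == false)]

/-- The contents of a stack that holds a partial assignment. -/
def bits (w : PartialAssignment) : List Bool :=
  w.flatMap entryBits

theorem bits_nil : bits [] = [] :=
  rfl

theorem bits_cons (o : Option Bool) (w : PartialAssignment) :
    bits (o :: w) = o.all (· == true) :: o.all (· == false) :: bits w :=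
  rfl

theorem bits_append (w₁ w₂ : PartialAssignment) : bits (w₁ ++ w₂) = bits w₁ ++ bits w₂ :=
  List.flatMap_append

theorem length_bits (w : PartialAssignment) : (bits w).length = 2 * w.length := by
  simp [bits, List.length_flatMap, entryBits, mul_comm]

theorem bits_split (w : PartialAssignment) (j : ℕ) :
    bits (w.take j) ++ (bits ((w.drop j).take 1) ++ bits (w.drop (j + 1))) = bits w := by
  rw [← List.drop_drop, ← bits_append, ← bits_append, List.take_append_drop,
    List.take_append_drop]

theorem allows_drop (w : PartialAssignment) (j : ℕ) (b : Bool) :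
    allows (w.drop j) 0 b = allows w j b := by
  simp [allows]

theorem length_increment (carry : Bool) (w : PartialAssignment) :
    (increment carry w).length = w.length := by
  induction w generalizing carry with
  | nil => rfl
  | cons o w ih => cases o <;> simp [increment, ih]

end PartialAssignment

open PartialAssignment

/-- Passes the unary number at the top of the input, which is the index of a variable, and the
entries of the partial assignment before the one of this variable. -/
def seek : StackProg Stk :=
  loop .inp (· == some true) (fun _ => push .inpDone true ;;
    pop .asg fun p => pop .asg fun q => pushOpt .asgDone p ;; pushOpt .asgDone q) ;;
  push .inpDone false

/-- Passes an entry of the partial assignment and records on the stack `k` whether it allows the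
value `b`. -/
def readEntry (k : Stk) (b : Bool) : StackProg Stk :=
  pop .asg fun p => pop .asg fun q => pushOpt .asgDone p ;; pushOpt .asgDone q ;;
    push k ((bif b then p else q).getD true)

/-- Passes the literal at the top of the input and records whether the partial assignment
allows it. -/
def readLiteral : StackProg Stk :=
  seek ;; pop .inp (fun b => pushOpt .inpDone b ;; readEntry .res (b.getD false)) ;;
    moveAll .asgDone .asg

/-- Outputs whether the variable whose index is at the top of the input may have the value `b`. -/
def outputEntry (b : Bool) : StackProg Stk :=
  seek ;; readEntry .out b ;; moveAll .asgDone .asg ;; moveAll .inpDone .inp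

/-- Passes an entry of the partial assignment whose first bit is `p` and adds the carry on the stack
`res` to it. -/
def incrEntry (p : Option Bool) : StackProg Stk :=
  pop .asg fun q => pop .res fun c =>
    bif p == q then pushList .asgDone [true, true] ;; pushOpt .res c
    else pushList .asgDone (entryBits (p.map (xor (c.getD false)))) ;;
      push .res (p.getD false && c.getD false)

/-- Replaces the partial assignment by the next one. -/
def incr : StackProg Stk :=
  push .res true ;; loop .asg Option.isSome incrEntry ;; pop .res (fun _ => skip) ;;
    moveAll .asgDone .asg

section

variable {s : Store} {w : PartialAssignment} {i : List Bool} {j : ℕ}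

theorem exec_move_entry (hw : s.asg = bits w) :
    Exec (pop .asg fun p => pop .asg fun q => pushOpt .asgDone p ;; pushOpt .asgDone q) s 4
      { s with asg := bits w.tail, asgDone := (bits (w.take 1)).reverse ++ s.asgDone } := by
  cases w with
  | nil => exact .cast (.pop hw (.pop rfl (.seq (.skip _) (.skip _)))) rfl (by omega)
  | cons o w => exact .pop hw (.pop rfl (.seq (.push _ _ _) (.push _ _ _)))

theorem exec_seek (hi : s.inp = List.replicate j true ++ false :: i) (hw : s.asg = bits w) :
    Exec seek s (6 * j + 2)
      { s with
        inp := i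
        inpDone := false :: (List.replicate j true ++ s.inpDone)
        asg := bits (w.drop j)
        asgDone := (bits (w.take j)).reverse ++ s.asgDone } := by
  suffices hloop : Exec (loop .inp (· == some true) fun _ => push .inpDone true ;;
      pop .asg fun p => pop .asg fun q => pushOpt .asgDone p ;; pushOpt .asgDone q) s (6 * j + 1)
      { s with
        inp := i
        inpDone := List.replicate j true ++ s.inpDone
        asg := bits (w.drop j)
        asgDone := (bits (w.take j)).reverse ++ s.asgDone } from
    hloop.seq (.push _ _ _)
  induction j generalizing s w with
  | zero => exact .cast (.loop_exit hi rfl) (by simp [Store.set, hw, bits_nil]) le_rfl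
  | succ j ih =>
    refine .cast (.loop_next hi rfl (.seq (.push _ _ _) (exec_move_entry hw)) (ih rfl rfl))
      ?_ (by omega)
    have htake : bits (w.take (j + 1)) = bits (w.take 1) ++ bits (w.tail.take j) := by
      cases w <;> simp [bits_cons, bits_nil]
    simp [Store.set, Store.get, htake, List.replicate_succ']

theorem exec_readEntry (hw : s.asg = bits w) {k : Stk} (hk : k ≠ .asg ∧ k ≠ .asgDone) (b : Bool) :
    Exec (readEntry k b) s 7
      (Store.set { s with asg := bits w.tail, asgDone := (bits (w.take 1)).reverse ++ s.asgDone }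
        k (allows w 0 b :: s.get k)) := by
  have hget (a d : List Bool) : Store.get { s with asg := a, asgDone := d } k = s.get k := by
    cases k <;> simp_all [Store.get]
  rw [← hget (bits w.tail) ((bits (w.take 1)).reverse ++ s.asgDone)]
  cases w with
  | nil =>
    refine .cast (.pop hw (.pop rfl (.seq (.skip _) (.seq (.skip _) (.push _ _ _))))) ?_
      (by omega)
    cases b <;> rfl
  | cons o w =>
    refine .cast (.pop hw (.pop rfl (.seq (.push _ _ _) (.seq (.push _ _ _) (.push _ _ _))))) ?_
      (by omega)
    cases b <;> rfl

theorem exec_readLiteral {b : Bool} (hi : s.inp = List.replicate j true ++ false :: b :: i)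
    (hw : s.asg = bits w) (hdone : s.asgDone = []) :
    Exec readLiteral s (10 * j + 16)
      { s with
        inp := i
        inpDone := b :: false :: (List.replicate j true ++ s.inpDone)
        res := allows w j b :: s.res } := by
  refine .cast (.seq (exec_seek hi hw) (.seq (.pop rfl (.seq (.push _ _ _)
    (exec_readEntry rfl (by decide) _))) (.moveAll _ (by decide)))) ?_ ?_
  · simp [Store.set, Store.get, hdone, hw, bits_split, allows_drop]
  · simp only [Store.get, Store.set, hdone, length_bits, List.tail_cons, List.append_nil,
      List.tail_drop, List.length_append, List.length_reverse, List.length_take,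
      List.length_drop]
    omega

theorem exec_outputEntry (hi : s.inp = List.replicate j true ++ false :: i)
    (hi' : s.inpDone = []) (hw : s.asg = bits w) (hw' : s.asgDone = []) (b : Bool) :
    Exec (outputEntry b) s (12 * j + 17) { s with out := allows w j b :: s.out } := by
  refine .cast (.seq (exec_seek hi hw) (.seq (exec_readEntry rfl (by decide) _)
    (.seq (.moveAll _ (by decide)) (.moveAll _ (by decide))))) ?_ ?_
  · simp [Store.set, Store.get, hi, hi', hw, hw', bits_split, allows_drop]
  · simp only [Store.get, Store.set, hi', hw', length_bits, List.append_nil, List.tail_drop,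
      List.length_append, List.length_reverse, List.length_take, List.length_drop,
      List.length_cons, List.length_replicate]
    omega

theorem exec_incrEntry {o : Option Bool} {c : Bool} {r : List Bool}
    (hw : s.asg = (bits (o :: w)).tail) (hr : s.res = c :: r) :
    ∃ o' c', increment c (o :: w) = o' :: increment c' w ∧
      Exec (incrEntry (bits (o :: w)).head?) s 5
        { s with
          asg := bits w
          asgDone := (entryBits o').reverse ++ s.asgDone
          res := c' :: r } := by
  rcases o with _ | b
  · exact ⟨none, c, rfl, .pop hw (.pop hr (.seq (.pushList _ _ _) (.push _ _ _)))⟩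
  · refine ⟨some (b ^^ c), b && c, rfl, .pop hw (.pop hr ?_)⟩
    cases b <;> cases c <;> exact .seq (.pushList _ _ _) (.push _ _ _)

theorem exec_loop_incrEntry {c : Bool} {r : List Bool} (hw : s.asg = bits w) (hr : s.res = c :: r) :
    ∃ c', Exec (loop .asg Option.isSome incrEntry) s (6 * w.length + 1)
      { s with
        asg := []
        asgDone := (bits (increment c w)).reverse ++ s.asgDone
        res := c' :: r } := by
  induction w generalizing c s with
  | nil =>
    exact ⟨c, .cast (.loop_exit hw rfl) (by simp [Store.set, increment, bits_nil, hr]) le_rfl⟩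
  | cons o w ih =>
    obtain ⟨o', c', ho, hentry⟩ :=
      exec_incrEntry (s := { s with asg := (bits (o :: w)).tail }) rfl hr
    obtain ⟨c'', hloop⟩ := ih (s := { s with
        asg := bits w, asgDone := (entryBits o').reverse ++ s.asgDone, res := c' :: r }) rfl rfl
    refine ⟨c'', .cast (.loop_next hw rfl hentry hloop) ?_ ?_⟩
    · simp [ho, bits]
    · rw [List.length_cons]
      omega

theorem exec_incr (hw : s.asg = bits w) (hw' : s.asgDone = []) :
    Exec incr s (10 * w.length + 4) { s with asg := bits (next w) } := by
  obtain ⟨c, hloop⟩ := exec_loop_incrEntry (s := { s with res := true :: s.res }) hw rfl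
  refine .cast (.seq (.push _ _ _) (.seq hloop (.seq (.pop rfl (.skip _))
    (.moveAll _ (by decide))))) ?_ ?_
  · simp [Store.set, Store.get, hw', next]
  · simp only [Store.get, Store.set, hw', length_bits, length_increment, List.append_nil,
      List.tail_cons, List.length_reverse]
    omega

end

/-! ### Evaluation of a formula -/

/-- The encoding of a clause. -/
def encodeClause {n : ℕ} (c : Fin 3 → Literal n) : List Bool :=
  (List.finRange 3).flatMap fun k => ThreeCNF.encodeLiteral (c k)

/-- The encoding of a list of clauses. -/
def encodeClauses {n : ℕ} (cs : List (Fin 3 → Literal n)) : List Bool :=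
  cs.flatMap encodeClause

/-- Whether every clause has a literal that is allowed by the partial assignment. -/
def passes {n : ℕ} (w : PartialAssignment) (cs : List (Fin 3 → Literal n)) : Bool :=
  cs.all fun c => (List.finRange 3).any fun k => allows w (c k).1 (c k).2

theorem encodeClause_eq {n : ℕ} (c : Fin 3 → Literal n) (l : List Bool) :
    encodeClause c ++ l = List.replicate (c 0).1 true ++ false :: (c 0).2 ::
      (List.replicate (c 1).1 true ++ false :: (c 1).2 ::
        (List.replicate (c 2).1 true ++ false :: (c 2).2 :: l)) := by
  simp [encodeClause, List.finRange_succ, ThreeCNF.encodeLiteral]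

theorem length_encodeClause_le {n : ℕ} (c : Fin 3 → Literal n) :
    (encodeClause c).length ≤ 3 * n + 3 := by
  have := (c 0).1.isLt
  have := (c 1).1.isLt
  have := (c 2).1.isLt
  rw [← List.append_nil (encodeClause c), encodeClause_eq]
  simp only [List.length_append, List.length_replicate, List.length_cons, List.length_nil]
  omega

theorem length_encodeClauses_le {n : ℕ} (cs : List (Fin 3 → Literal n)) :
    (encodeClauses cs).length ≤ cs.length * (3 * n + 3) := by
  rw [encodeClauses, List.length_flatMap, ← smul_eq_mul,
    ← List.length_map (f := fun c => (encodeClause c).length)]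
  refine List.sum_le_card_nsmul _ _ fun m hm => ?_
  obtain ⟨c, -, rfl⟩ := List.mem_map.1 hm
  exact length_encodeClause_le c

theorem exists_encodeClause_eq_cons {n : ℕ} (c : Fin 3 → Literal n) :
    ∃ b l, encodeClause c = b :: l := by
  refine List.ne_nil_iff_exists_cons.1 fun h => ?_
  simpa [h] using encodeClause_eq c []

/-- Evaluates the clause at the top of the input. The value of the clauses before is at the top
of the stack `res` and is replaced by the value of these clauses together with the present one. -/
def readClause : StackProg Stk :=
  readLiteral ;; readLiteral ;; readLiteral ;;
    pop .res fun z => pop .res fun y => pop .res fun x => pop .res fun g =>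
      push .res (g.getD false && (x.getD false || (y.getD false || z.getD false)))

/-- Outputs whether every clause of the input has a literal allowed by the partial assignment. -/
def outputValue : StackProg Stk :=
  push .res true ;; loop .inp Option.isSome (fun b => pushOpt .inp b ;; readClause) ;;
    moveAll .inpDone .inp ;; pop .res (pushOpt .out)

section

variable {s : Store} {w : PartialAssignment} {n : ℕ} {g : Bool} {r : List Bool}

theorem exec_readClause {c : Fin 3 → Literal n} {i : List Bool} (hi : s.inp = encodeClause c ++ i)
    (hw : s.asg = bits w) (hw' : s.asgDone = []) (hr : s.res = g :: r) :
    Exec readClause s (30 * n + 23)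
      { s with
        inp := i
        inpDone := (encodeClause c).reverse ++ s.inpDone
        res := (g && passes w [c]) :: r } := by
  have := (c 0).1.isLt
  have := (c 1).1.isLt
  have := (c 2).1.isLt
  rw [encodeClause_eq] at hi
  refine .cast (.seq (exec_readLiteral hi hw hw') (.seq (exec_readLiteral rfl hw hw')
    (.seq (exec_readLiteral rfl hw hw')
      (.pop rfl (.pop rfl (.pop rfl (.pop hr (.push _ _ _)))))))) ?_ (by omega)
  have henc := encodeClause_eq c []
  rw [List.append_nil] at henc
  simp [Store.set, Store.get, henc, passes, List.finRange_succ, hr]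

theorem exec_loop_readClause {cs : List (Fin 3 → Literal n)} (hi : s.inp = encodeClauses cs)
    (hw : s.asg = bits w) (hw' : s.asgDone = []) (hr : s.res = g :: r) :
    Exec (loop .inp Option.isSome fun b => pushOpt .inp b ;; readClause) s
      (cs.length * (30 * n + 25) + 1)
      { s with
        inp := []
        inpDone := (encodeClauses cs).reverse ++ s.inpDone
        res := (g && passes w cs) :: r } := by
  induction cs generalizing s g with
  | nil =>
    refine .cast (.loop_exit hi rfl) ?_ (by simp)
    simp [Store.set, encodeClauses, passes, hr]
  | cons c cs ih =>
    obtain ⟨b, l, hc⟩ := exists_encodeClause_eq_cons c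
    have hi' : s.inp = b :: (l ++ encodeClauses cs) := by
      rw [hi, encodeClauses, List.flatMap_cons, hc]
      rfl
    have hclause := exec_readClause (s := { s with inp := b :: (l ++ encodeClauses cs) })
      (c := c) (by rw [hc]; rfl) hw hw' hr
    refine .cast (.loop_next hi' rfl (.seq (.push _ _ _) hclause) (ih rfl hw hw' rfl)) ?_ ?_
    · simp [encodeClauses, passes, Bool.and_assoc]
    · simp only [List.length_cons, add_mul]
      omega

theorem exec_outputValue {cs : List (Fin 3 → Literal n)} (hi : s.inp = encodeClauses cs)
    (hi' : s.inpDone = []) (hw : s.asg = bits w) (hw' : s.asgDone = []) :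
    Exec outputValue s (cs.length * (36 * n + 31) + 5) { s with out := passes w cs :: s.out } := by
  refine .cast (.seq (.push _ _ _) (.seq (exec_loop_readClause (cs := cs) hi hw hw' rfl)
    (.seq (.moveAll _ (by decide)) (.pop rfl (.push _ _ _))))) ?_ ?_
  · simp [Store.set, Store.get, hi, hi']
  · have := length_encodeClauses_le cs
    simp only [Store.get, Store.set, hi', List.append_nil, List.length_reverse]
    nlinarith

end

/-! ### Loops over assignments, columns and residues -/

/-- Executes `B` once for each of the successors of the partial assignment, including itself. Their
number is taken from the stack `num`. -/
def forAssignments (B : StackProg Stk) : StackProg Stk :=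
  forUnary .num .numDone (B ;; incr)

/-- Executes `B` once for each column, with the index of the column in unary at the top of the
input. The number of columns is taken from the stack `ctr`. -/
def forColumns (B : StackProg Stk) : StackProg Stk :=
  push .inp false ;; forUnary .ctr .ctrDone (B ;; push .inp true) ;;
    loop .inp (· == some true) fun _ => skip

/-- Executes `E (f (m % k))` for each number `m` less than the one on the stack `ctr`. The values of
`f` on the remaining residues are kept on the stack `res`. -/
def forPeriodic (k : ℕ) (f : ℕ → Bool) (E : Bool → StackProg Stk) : StackProg Stk :=
  forUnary .ctr .ctrDone (pop .res fun b =>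
    b.elim (pushList .res (((List.range k).map f).drop 1).reverse ;; E (f 0)) E) ;;
  clear .res

section

variable {s : Store} {B : StackProg Stk} {t : ℕ}

theorem exec_forAssignments {w : PartialAssignment} {M : ℕ} {bit : PartialAssignment → Bool}
    (hM : next^[M] w = w) (hnum : s.num = List.replicate M true) (hnum' : s.numDone = [])
    (hw : s.asg = bits w) (hw' : s.asgDone = [])
    (hB : ∀ v l l' o, Exec B
      { s with asg := bits (next^[v] w), num := l, numDone := l', out := o } t
      { s with asg := bits (next^[v] w), num := l, numDone := l', out := bit (next^[v] w) :: o }) :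
    Exec (forAssignments B) s (M * (t + 10 * w.length + 8) + 2)
      { s with out := ((List.range M).map fun v => bit (next^[v] w)).reverse ++ s.out } := by
  have hlen (v : ℕ) : (next^[v] w).length = w.length :=
    congrFun (Function.iterate_invariant (funext (length_increment true)) v) w
  refine .cast (.forUnary (by decide) (n := M) (F := fun v => { s with
      asg := bits (next^[v] w)
      out := ((List.range v).map fun v => bit (next^[v] w)).reverse ++ s.out })
    (t := t + (10 * w.length + 4)) ?_ fun v _ l l' => ?_) ?_ ?_
  · cases s
    simp_all [Store.set]
  · refine .cast (.seq (hB v l l' _) (exec_incr (w := next^[v] w) rfl hw')) ?_ ?_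
    · simp [Store.set, List.range_succ, Function.iterate_succ_apply']
    · rw [hlen]
  · simp [Store.set, ← hnum, hnum', ← hw, hM]
  · ring_nf
    rfl

theorem exec_drop_replicate {n : ℕ} {i : List Bool}
    (hi : s.inp = List.replicate n true ++ false :: i) :
    Exec (loop .inp (· == some true) fun _ => skip) s (n + 1) { s with inp := i } := by
  induction n generalizing s with
  | zero => exact .cast (.loop_exit hi rfl) rfl le_rfl
  | succ n ih => exact .cast (.loop_next hi rfl (.skip _) (ih rfl)) rfl (by omega)

theorem exec_forColumns {n : ℕ} {g : ℕ → List Bool} (hctr : s.ctr = List.replicate n true)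
    (hctr' : s.ctrDone = [])
    (hB : ∀ j < n, ∀ l l' o, Exec B
      { s with inp := List.replicate j true ++ false :: s.inp, ctr := l, ctrDone := l', out := o } t
      { s with
        inp := List.replicate j true ++ false :: s.inp
        ctr := l
        ctrDone := l'
        out := (g j).reverse ++ o }) :
    Exec (forColumns B) s (n * (t + 6) + 4)
      { s with out := ((List.range n).flatMap g).reverse ++ s.out } := by
  refine .cast (.seq (.push _ _ _) (.seq (.forUnary (by decide) (n := n) (F := fun j => { s with
      inp := List.replicate j true ++ false :: s.inp
      out := ((List.range j).flatMap g).reverse ++ s.out })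
    (t := t + 1) ?_ fun j hj l l' => ?_) (exec_drop_replicate (n := n) rfl))) ?_ ?_
  · simp [Store.set, Store.get, ← hctr, hctr']
  · refine .cast (.seq (hB j hj l l' _) (.push _ _ _)) ?_ le_rfl
    simp [Store.set, Store.get, List.range_succ, List.replicate_succ]
  · simp [Store.set, ← hctr, ← hctr']
  · ring_nf
    omega

theorem add_one_mod (m : ℕ) {k : ℕ} (hk : 0 < k) :
    (m + 1) % k = if m % k + 1 = k then 0 else m % k + 1 := by
  have := Nat.mod_lt m hk
  rw [← Nat.mod_add_mod]
  split_ifs with h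
  · rw [h, Nat.mod_self]
  · exact Nat.mod_eq_of_lt (by omega)

theorem exec_forPeriodic {k n : ℕ} (hk : 0 < k) {f : ℕ → Bool} {E : Bool → StackProg Stk}
    {F : ℕ → Store} (hs : s = { F 0 with ctr := List.replicate n true, ctrDone := [], res := [] })
    (hE : ∀ m < n, ∀ l l' r, Exec (E (f (m % k)))
      { F m with ctr := l, ctrDone := l', res := r } t
      { F (m + 1) with ctr := l, ctrDone := l', res := r }) :
    Exec (forPeriodic k f E) s (n * (t + k + 5) + k + 3)
      { F n with ctr := List.replicate n true, ctrDone := [], res := [] } := by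
  obtain ⟨rem, hrem⟩ : ∃ rem : ℕ → List Bool, ∀ m, rem m =
      if m % k = 0 then [] else ((List.range k).map f).drop (m % k) := ⟨_, fun _ => rfl⟩
  have hlen (m : ℕ) : (rem m).length ≤ k := by
    rw [hrem]
    split_ifs <;> simp
  have hsucc (m : ℕ) : rem (m + 1) = ((List.range k).map f).drop (m % k + 1) := by
    rw [hrem, add_one_mod m hk]
    split_ifs <;> simp_all
  have hzero (m : ℕ) (hm : m % k = 0) : rem m = [] := by
    rw [hrem, if_pos hm]
  have hcons (m : ℕ) (hm : m % k ≠ 0) : rem m = f (m % k) :: rem (m + 1) := by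
    rw [hrem, if_neg hm, hsucc, List.drop_eq_getElem_cons (by simpa using Nat.mod_lt m hk)]
    simp
  refine .cast (.seq (.forUnary (by decide) (F := fun m => { F m with res := rem m }) (n := n)
    (t := t + k + 1) (by simp [Store.set, hs, hzero 0 (Nat.zero_mod k)]) fun m hm l l' => ?_)
    (.clear _ _)) rfl ?_
  · by_cases hmk : m % k = 0
    · have hE := hE m hm l l' (rem (m + 1))
      rw [hmk] at hE
      refine .cast (.pop (hzero m hmk) (.seq (.pushList _ _ _) (hE.cast_left ?_))) rfl ?_
      · simp [Store.set, Store.get, hsucc, hmk]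
      · simp only [List.length_reverse, List.length_drop, List.length_map, List.length_range]
        omega
    · exact .cast (.pop (hcons m hmk) (hE m hm l l' (rem (m + 1)))) rfl (by omega)
  · have hlen := hlen n
    simp only [Store.get, Store.set]
    rw [show t + k + 5 = t + k + 1 + 4 by ring]
    omega

end

/-! ### The program of the reduction -/

/-- The partial assignment that agrees with `α` on those of the variables `0, …, n - 1` that
satisfy `p`. -/
def restrict (p α : ℕ → Bool) (n : ℕ) : PartialAssignment :=
  (List.range n).map fun j => if p j then some (α j) else none

/-- The cells of the column `j < n` test the value of the variable `j`, those of the last column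
test whether all clauses pass, whatever the bit `a` is. -/
def columnBit {n : ℕ} (cs : List (Fin 3 → Literal n)) (j : ℕ) (a : Bool) (w : PartialAssignment) :
    Bool :=
  if j < n then allows w j a else passes w cs

/-- The table of a cell that tests the `M` successors of `w`. The additional value `M` belongs to
the table if `extra` is set. -/
def tableBits (test : Bool → PartialAssignment → Bool) (w : PartialAssignment) (M : ℕ)
    (extra : Bool) : List Bool :=
  [false, true].flatMap fun a => (List.range M).map (fun v => test a (next^[v] w)) ++ [extra]

/-- The tables of a row for the partial assignments of the variables that satisfy `p`. -/
def rowBits {n : ℕ} (cs : List (Fin 3 → Literal n)) (p : ℕ → Bool) (M : ℕ) : List Bool :=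
  (List.range (n + 1)).flatMap fun j =>
    tableBits (columnBit cs j) (restrict p (fun _ => false) n) M (decide (j = n))

/-- The number of assignments of as many variables as there can be in three residue classes
modulo `k`. No class contains more variables than the one of `0`. -/
def numAssignments (k n : ℕ) : ℕ :=
  8 ^ Nat.count (· % k = 0) n

/-- Moves the number at the top of the input to the stack `ctr`. -/
def readNumVars : StackProg Stk :=
  loop .inp (· == some true) fun _ => push .ctr true

/-- Outputs the successor of the number on the stack `k`, followed by a delimiter. -/
def outputSucc (k k' : Stk) : StackProg Stk :=
  forUnary k k' (push .out true) ;; pushList .out [true, false]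

/-- Multiplies the number on the stack `num` by eight. -/
def octuple : StackProg Stk :=
  forUnary .num .numDone (pushList .asg (List.replicate 7 true)) ;; moveAll .asg .num

/-- Computes `numAssignments k n`, where `n` is the number on the stack `ctr`. -/
def buildNum (k : ℕ) : StackProg Stk :=
  push .num true ;; forPeriodic k (· == 0) fun b => bif b then octuple else skip

/-- Builds the first partial assignment of the variables that satisfy `p`. -/
def buildAssignment (k : ℕ) (p : ℕ → Bool) : StackProg Stk :=
  forPeriodic k p (fun b => pushList .asgDone (entryBits (if b then some false else none))) ;;
    moveAll .asgDone .asg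

/-- Outputs the table of a cell whose tests are computed by `B`. -/
def outputTable (B : Bool → StackProg Stk) (extra : Bool) : StackProg Stk :=
  forAssignments (B false) ;; push .out extra ;; forAssignments (B true) ;; push .out extra

/-- Outputs a row. -/
def outputRow (k : ℕ) (p : ℕ → Bool) : StackProg Stk :=
  buildAssignment k p ;; forColumns (outputTable outputEntry false) ;;
    outputTable (fun _ => outputValue) true ;; clear .asg

/-- Outputs the rows of a list. -/
def outputRows (k : ℕ) (l : List (ℕ → Bool)) : StackProg Stk :=
  l.foldr (fun p P => outputRow k p ;; P) skip

/-- The program that computes the tiling instance whose rows are given by a list. -/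
def reduction (k : ℕ) (l : List (ℕ → Bool)) : StackProg Stk :=
  readNumVars ;; pushList .out (List.replicate l.length true ++ [false]) ;;
    outputSucc .ctr .ctrDone ;; buildNum k ;; outputSucc .num .numDone ;;
    outputRows k l ;; clear .inp ;; clear .ctr ;; clear .num

/-- The store at the beginning of each row. -/
def rowStore {n : ℕ} (cs : List (Fin 3 → Literal n)) (M : ℕ) (o : List Bool) : Store where
  inp := encodeClauses cs
  ctr := List.replicate n true
  num := List.replicate M true
  out := o

section

variable {s : Store} {n k : ℕ}

theorem exec_readNumVars {i : List Bool} (hi : s.inp = List.replicate n true ++ false :: i) :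
    Exec readNumVars s (2 * n + 1)
      { s with inp := i, ctr := List.replicate n true ++ s.ctr } := by
  induction n generalizing s with
  | zero => exact .cast (.loop_exit hi rfl) rfl le_rfl
  | succ n ih =>
    refine .cast (.loop_next hi rfl (.push _ _ _) (ih rfl)) ?_ (by omega)
    simp [Store.set, Store.get, List.replicate_succ']

theorem exec_outputSucc {k k' : Stk} (hk : k ≠ k' ∧ k ≠ .out ∧ k' ≠ .out)
    (hn : s.get k = List.replicate n true) (hn' : s.get k' = []) :
    Exec (outputSucc k k') s (n * 5 + 4)
      { s with out := false :: (List.replicate (n + 1) true ++ s.out) } := by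
  have hset (o : List Bool) :
      (Store.set { s with out := o } k (List.replicate n true)).set k' [] =
        { s with out := o } := by
    rw [← hn, ← hn']
    cases k <;> cases k' <;> simp_all [Store.set, Store.get]
  refine .cast (.seq (.forUnary hk.1 (n := n) (t := 1)
    (F := fun m => { s with out := List.replicate m true ++ s.out }) (hset _).symm
    fun m _ l l' => .cast (.push _ _ _) ?_ le_rfl) (.pushList _ _ _)) ?_ le_rfl
  · cases k <;> cases k' <;> simp_all [Store.set, Store.get, List.replicate_succ]
  · rw [hset]
    simp [Store.set, Store.get, List.replicate_succ]

theorem exec_octuple (hnum : s.num = List.replicate n true) (hnum' : s.numDone = [])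
    (hw : s.asg = []) :
    Exec octuple s (25 * n + 3) { s with num := List.replicate (8 * n) true } := by
  refine .cast (.seq (.forUnary (by decide) (n := n) (t := 7)
    (F := fun m => { s with asg := List.replicate (7 * m) true }) ?_
    fun m _ l l' => .cast (.pushList _ _ _) ?_ le_rfl) (.moveAll _ (by decide))) ?_ ?_
  · cases s
    simp_all [Store.set]
  · simp [Store.set, Store.get, mul_add, List.replicate_succ]
  · simp [Store.set, Store.get, hnum', ← hw, show 7 * n + n = 8 * n by ring]
  · simp only [Store.set, Store.get, List.length_replicate]
    omega

theorem numAssignments_mono (k : ℕ) : Monotone (numAssignments k) :=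
  fun _ _ h => Nat.pow_le_pow_right (by norm_num) (Nat.count_monotone _ h)

theorem numAssignments_succ (k m : ℕ) : numAssignments k (m + 1) =
    bif m % k == 0 then 8 * numAssignments k m else numAssignments k m := by
  cases h : m % k == 0 <;> simp_all [numAssignments, Nat.count_succ, pow_succ']

theorem exec_buildNum (hk : 0 < k) (hctr : s.ctr = List.replicate n true) (hctr' : s.ctrDone = [])
    (hnum : s.num = []) (hnum' : s.numDone = []) (hw : s.asg = []) (hr : s.res = []) :
    Exec (buildNum k) s (n * (25 * numAssignments k n + k + 8) + k + 4)
      { s with num := List.replicate (numAssignments k n) true } := by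
  refine .cast (.seq (.push _ _ _) (exec_forPeriodic hk (n := n) (t := 25 * numAssignments k n + 3)
    (F := fun m => { s with num := List.replicate (numAssignments k m) true }) ?_
    fun m hm l l' r => ?_)) ?_ ?_
  · simp [Store.set, Store.get, numAssignments, hnum, ← hctr, hctr', hr]
  · have hle := numAssignments_mono k hm.le
    rw [numAssignments_succ]
    cases m % k == 0
    · exact .cast (.skip _) rfl (by omega)
    · exact .cast (exec_octuple rfl hnum' hw) rfl (by omega)
  · simp [← hctr, hctr', hr]
  · ring_nf
    omega

theorem exec_buildAssignment (hk : 0 < k) {p : ℕ → Bool} (hp : Function.Periodic p k)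
    (hctr : s.ctr = List.replicate n true) (hctr' : s.ctrDone = []) (hw : s.asg = [])
    (hw' : s.asgDone = []) (hr : s.res = []) :
    Exec (buildAssignment k p) s (n * (k + 11) + k + 4)
      { s with asg := bits (restrict p (fun _ => false) n) } := by
  refine .cast (.seq (exec_forPeriodic hk (n := n) (t := 2)
    (F := fun m => { s with asgDone := (bits (restrict p (fun _ => false) m)).reverse }) ?_
    fun m _ l l' r => .cast (.pushList _ _ _) ?_ le_rfl) (.moveAll _ (by decide))) ?_ ?_
  · cases s
    simp_all [restrict, bits]
  · simp [Store.set, Store.get, hp.map_mod_nat, restrict, List.range_succ, bits]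
  · cases s
    simp_all [Store.set, Store.get]
  · simp only [Store.get, List.length_reverse, length_bits, restrict, List.length_map,
      List.length_range]
    ring_nf
    omega

theorem exec_outputTable {w : PartialAssignment} {M t : ℕ} {test : Bool → PartialAssignment → Bool}
    {B : Bool → StackProg Stk} (hM : next^[M] w = w) (hnum : s.num = List.replicate M true)
    (hnum' : s.numDone = []) (hw : s.asg = bits w) (hw' : s.asgDone = []) (extra : Bool)
    (hB : ∀ a v l l' o, Exec (B a)
      { s with asg := bits (next^[v] w), num := l, numDone := l', out := o } t
      { s with
        asg := bits (next^[v] w)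
        num := l
        numDone := l'
        out := test a (next^[v] w) :: o }) :
    Exec (outputTable B extra) s (2 * (M * (t + 10 * w.length + 8) + 3))
      { s with out := (tableBits test w M extra).reverse ++ s.out } := by
  refine .cast (.seq (exec_forAssignments hM hnum hnum' hw hw' (hB false)) (.seq (.push _ _ _)
    (.seq (exec_forAssignments hM hnum hnum' hw hw' (hB true)) (.push _ _ _)))) ?_ (by omega)
  simp [Store.set, Store.get, tableBits]

variable {w : PartialAssignment} {M : ℕ} (cs : List (Fin 3 → Literal n))

theorem exec_outputEntries (hw : w.length = n) (hM : next^[M] w = w) (o : List Bool) :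
    Exec (forColumns (outputTable outputEntry false)) { rowStore cs M o with asg := bits w }
      (n * (2 * (M * (22 * n + 25) + 3) + 6) + 4)
      { rowStore cs M (((List.range n).flatMap fun j =>
          tableBits (fun a w => allows w j a) w M false).reverse ++ o) with asg := bits w } := by
  refine exec_forColumns (n := n) (s := { rowStore cs M o with asg := bits w }) rfl rfl
    fun j hj l l' o' => ?_
  refine .cast (exec_outputTable (test := fun a w => allows w j a) (t := 12 * n + 17) hM rfl rfl
    rfl rfl false fun a v l l' o => .cast (exec_outputEntry rfl rfl rfl rfl a) rfl (by omega))
    rfl ?_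
  rw [hw]
  exact le_of_eq (by ring)

theorem exec_outputValues (hw : w.length = n) (hM : next^[M] w = w) (o : List Bool) :
    Exec (outputTable (fun _ => outputValue) true) { rowStore cs M o with asg := bits w }
      (2 * (M * (cs.length * (36 * n + 31) + 10 * n + 13) + 3))
      { rowStore cs M ((tableBits (fun _ w => passes w cs) w M true).reverse ++ o) with
        asg := bits w } := by
  refine .cast (exec_outputTable (test := fun _ w => passes w cs)
    (s := { rowStore cs M o with asg := bits w }) hM rfl rfl rfl rfl true
    fun _ v l l' o => exec_outputValue (cs := cs) rfl rfl rfl rfl) rfl ?_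
  rw [hw]
  exact le_of_eq (by ring)

theorem length_restrict (p α : ℕ → Bool) (n : ℕ) : (restrict p α n).length = n := by
  simp [restrict]

theorem rowBits_eq (p : ℕ → Bool) : rowBits cs p M =
    ((List.range n).flatMap fun j =>
      tableBits (fun a w => allows w j a) (restrict p (fun _ => false) n) M false) ++
    tableBits (fun _ w => passes w cs) (restrict p (fun _ => false) n) M true := by
  rw [rowBits, List.range_succ, List.flatMap_append, List.flatMap_singleton]
  congr 1
  · refine List.flatMap_congr fun j hj => ?_
    rw [List.mem_range] at hj
    simp [tableBits, columnBit, hj, hj.ne]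
  · simp [tableBits, columnBit]

/-- A bound on the time for the output of a row for `n` variables and `m` clauses. -/
def rowTime (k n M m : ℕ) : ℕ :=
  n * (k + 11) + k + 4 + (n * (2 * (M * (22 * n + 25) + 3) + 6) + 4 +
    (2 * (M * (m * (36 * n + 31) + 10 * n + 13) + 3) + (2 * n + 1)))

theorem exec_outputRow (hk : 0 < k) {p : ℕ → Bool} (hp : Function.Periodic p k)
    (hM : next^[M] (restrict p (fun _ => false) n) = restrict p (fun _ => false) n)
    (o : List Bool) :
    Exec (outputRow k p) (rowStore cs M o) (rowTime k n M cs.length)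
      (rowStore cs M ((rowBits cs p M).reverse ++ o)) := by
  have hlen := length_restrict p (fun _ => false) n
  refine .cast (.seq (exec_buildAssignment (n := n) hk hp rfl rfl rfl rfl rfl)
    (.seq (exec_outputEntries cs hlen hM o) (.seq (exec_outputValues cs hlen hM _)
      (.clear _ _)))) ?_ ?_
  · simp [Store.set, rowStore, rowBits_eq]
  · simp [Store.get, length_bits, hlen, rowTime]

theorem exec_outputRows (hk : 0 < k) {l : List (ℕ → Bool)} (hp : ∀ p ∈ l, Function.Periodic p k)
    (hM : ∀ p ∈ l, next^[M] (restrict p (fun _ => false) n) = restrict p (fun _ => false) n)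
    (o : List Bool) :
    Exec (outputRows k l) (rowStore cs M o) (l.length * rowTime k n M cs.length)
      (rowStore cs M ((l.flatMap fun p => rowBits cs p M).reverse ++ o)) := by
  induction l generalizing o with
  | nil => exact .cast (.skip _) rfl (Nat.zero_le _)
  | cons p l ih =>
    rw [List.forall_mem_cons] at hp hM
    refine .cast (.seq (exec_outputRow cs hk hp.1 hM.1 o) (ih hp.2 hM.2 _)) ?_ ?_
    · simp
    · rw [List.length_cons, add_one_mul, add_comm]

/-- A bound on the time of the reduction to an instance with `x` rows, for `n` variables and
`m` clauses. -/
def reductionTime (k x n m : ℕ) : ℕ :=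
  x * (rowTime k n (numAssignments k n) m + 1) + m * (3 * n + 3) +
    (n + 1) * (30 * numAssignments k n + k + 20) + k

theorem exec_reduction (hk : 0 < k) {l : List (ℕ → Bool)} (hp : ∀ p ∈ l, Function.Periodic p k)
    (hM : ∀ p ∈ l, next^[numAssignments k n] (restrict p (fun _ => false) n) =
      restrict p (fun _ => false) n) :
    Exec (reduction k l) { inp := List.replicate n true ++ false :: encodeClauses cs }
      (reductionTime k l.length n cs.length)
      { out := (List.replicate l.length true ++ [false] ++ List.replicate (n + 1) true ++ [false] ++
          List.replicate (numAssignments k n + 1) true ++ [false] ++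
          l.flatMap fun p => rowBits cs p (numAssignments k n)).reverse } := by
  refine .cast (.seq (exec_readNumVars rfl) (.seq (.pushList _ _ _)
    (.seq (exec_outputSucc (n := n) (by decide) (List.append_nil _) rfl)
    (.seq (exec_buildNum (n := n) hk (List.append_nil _) rfl rfl rfl rfl rfl)
    (.seq (exec_outputSucc (by decide) rfl rfl)
    (.seq (.cast_left (exec_outputRows cs hk hp hM (List.replicate l.length true ++ [false] ++
      List.replicate (n + 1) true ++ [false] ++ List.replicate (numAssignments k n + 1) true ++
      [false]).reverse) ?_)
    (.seq (.clear _ _) (.seq (.clear _ _) (.clear _ _))))))))) ?_ ?_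
  · simp [Store.set, Store.get, rowStore]
  · simp [Store.set, rowStore]
  · have := length_encodeClauses_le cs
    simp only [Store.set, Store.get, rowStore, reductionTime, List.length_append,
      List.length_replicate, List.length_singleton]
    nlinarith

end

/-! ### The successors of a partial assignment -/

theorem restrict_succ (p α : ℕ → Bool) (n : ℕ) : restrict p α (n + 1) =
    (if p 0 then some (α 0) else none) :: restrict (fun j => p (j + 1)) (fun j => α (j + 1)) n := by
  simp [restrict, List.range_succ_eq_map]

theorem iterate_next_none_cons (w : PartialAssignment) (v : ℕ) :
    next^[v] (none :: w) = none :: next^[v] w := by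
  induction v generalizing w with
  | zero => rfl
  | succ _ ih => exact ih (next w)

theorem increment_false (w : PartialAssignment) : increment false w = w := by
  induction w with
  | nil => rfl
  | cons o w ih => cases o <;> simp [increment, ih]

theorem next_some_false_cons (w : PartialAssignment) :
    next (some false :: w) = some true :: w := by
  simp [next, increment, increment_false]

theorem iterate_next_some_cons (w : PartialAssignment) (v : ℕ) :
    next^[2 * v] (some false :: w) = some false :: next^[v] w := by
  induction v generalizing w with
  | zero => rfl
  | succ v ih =>
    rw [mul_add, iterate_add_apply, iterate_succ_apply, next_some_false_cons]
    exact ih (next w)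

theorem iterate_next_two_pow {p : ℕ → Bool} {n c : ℕ} (hc : Nat.count (p ·) n ≤ c) :
    next^[2 ^ c] (restrict p (fun _ => false) n) = restrict p (fun _ => false) n := by
  induction n generalizing p c with
  | zero => exact iterate_fixed rfl _
  | succ n ih =>
    rw [Nat.count_succ'] at hc
    rw [restrict_succ]
    split_ifs at hc ⊢
    · obtain ⟨c, rfl⟩ : ∃ c', c = c' + 1 := ⟨c - 1, by omega⟩
      rw [pow_succ', iterate_next_some_cons, ih (by omega)]
    · rw [iterate_next_none_cons, ih hc]

theorem exists_iterate_next_eq_restrict {p : ℕ → Bool} (α : ℕ → Bool) {n c : ℕ}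
    (hc : Nat.count (p ·) n ≤ c) :
    ∃ v < 2 ^ c, next^[v] (restrict p (fun _ => false) n) = restrict p α n := by
  induction n generalizing p α c with
  | zero => exact ⟨0, by positivity, rfl⟩
  | succ n ih =>
    rw [Nat.count_succ'] at hc
    simp only [restrict_succ]
    split_ifs at hc ⊢
    · obtain ⟨c, rfl⟩ : ∃ c', c = c' + 1 := ⟨c - 1, by omega⟩
      obtain ⟨v, hv, h⟩ := ih (p := fun j => p (j + 1)) (fun j => α (j + 1)) (c := c) (by omega)
      rw [pow_succ]
      cases α 0
      · exact ⟨2 * v, by omega, by rw [iterate_next_some_cons, h]⟩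
      · refine ⟨2 * v + 1, by omega, ?_⟩
        rw [iterate_succ_apply', iterate_next_some_cons, h, next_some_false_cons]
    · obtain ⟨v, hv, h⟩ := ih (fun j => α (j + 1)) hc
      exact ⟨v, hv, by rw [iterate_next_none_cons, h]⟩

theorem map_isSome_increment (carry : Bool) (w : PartialAssignment) :
    (increment carry w).map Option.isSome = w.map Option.isSome := by
  induction w generalizing carry with
  | nil => rfl
  | cons o w ih => cases o <;> simp [increment, ih]

theorem isSome_iterate_next (w : PartialAssignment) (v j : ℕ) :
    ((next^[v] w).getD j none).isSome = (w.getD j none).isSome := by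
  have h : (next^[v] w).map Option.isSome = w.map Option.isSome :=
    congrFun (iterate_invariant (funext (map_isSome_increment true)) v) w
  have hj := congrArg (fun l => l.getD j (Option.isSome (none : Option Bool))) h
  rwa [List.getD_map, List.getD_map] at hj

theorem isSome_restrict (p α : ℕ → Bool) {n j : ℕ} (hj : j < n) :
    ((restrict p α n).getD j none).isSome = p j := by
  cases h : p j <;> simp [restrict, hj, h]

theorem allows_restrict (p α : ℕ → Bool) (n j : ℕ) : allows (restrict p α n) j (α j) := by
  by_cases hj : j < n <;> cases h : p j <;> simp [restrict, allows, hj, h]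

theorem eq_of_allows {w : PartialAssignment} {j : ℕ} {b b' : Bool}
    (hj : (w.getD j none).isSome) (hb : allows w j b) (hb' : allows w j b') : b = b' := by
  obtain ⟨a, ha⟩ := Option.isSome_iff_exists.1 hj
  simp_all [allows]

/-! ### The tiling instance of a formula -/

theorem NarrowGridTiling.isYes_iff (I : NarrowGridTiling) :
    I.IsYes ↔ ∃ (A : Fin I.y → Bool) (V : Fin I.x → Fin I.N), ∀ i j, (A j, V i) ∈ I.S i j := by
  constructor
  · rintro ⟨s, hs⟩
    have hcol : ∀ i j, (s i j).1 = (s ⟨0, I.x_pos⟩ j).1 := by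
      rintro ⟨i, hi⟩ j
      induction i with
      | zero => rfl
      | succ i ih => exact (hs.vertical ⟨i, by omega⟩ _ j rfl).symm.trans (ih (by omega))
    have hrow : ∀ i j, (s i j).2 = (s i ⟨0, I.y_pos⟩).2 := by
      rintro i ⟨j, hj⟩
      induction j with
      | zero => rfl
      | succ j ih => exact (hs.horizontal i ⟨j, by omega⟩ _ rfl).symm.trans (ih (by omega))
    refine ⟨fun j => (s ⟨0, I.x_pos⟩ j).1, fun i => (s i ⟨0, I.y_pos⟩).2, fun i j => ?_⟩
    dsimp only
    rw [← hcol i j, ← hrow i j]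
    exact hs.mem i j
  · rintro ⟨A, V, h⟩
    exact ⟨fun i j => (A j, V i), h, fun _ _ _ _ => rfl, fun _ _ _ _ => rfl⟩

theorem map_finRange_succ {β : Type*} {M : ℕ} {f : Fin (M + 1) → β} {g : ℕ → β} {b : β}
    (hf : ∀ v, f v = if (v : ℕ) < M then g v else b) :
    (List.finRange (M + 1)).map f = (List.range M).map g ++ [b] := by
  rw [List.finRange_succ_last, ← List.map_coe_finRange_eq_range, List.map_append, List.map_map,
    List.map_map]
  exact congrArg₂ _ (List.map_congr_left fun v _ => (hf v.castSucc).trans (if_pos v.isLt))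
    (congrArg (fun c => [c]) ((hf (Fin.last M)).trans (if_neg (lt_irrefl M))))

/-- The tiling instance of a formula in which the values of the row `i` stand for the first `M`
partial assignments of the variables that satisfy `p i`. As the sets of the last column must not be
empty, they contain the additional value `M`, which belongs to no other column. -/
def tiling (φ : ThreeCNF) {x M : ℕ} (p : Fin x → ℕ → Bool) (hx : 0 < x) (hM : 0 < M) :
    NarrowGridTiling where
  x := x
  y := φ.numVars + 1
  N := M + 1
  x_pos := hx
  y_pos := φ.numVars.succ_pos
  S i j := Finset.univ.filter fun av =>
    if (av.2 : ℕ) < M then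
      columnBit φ.clauses j av.1 (next^[av.2] (restrict (p i) (fun _ => false) φ.numVars))
    else decide ((j : ℕ) = φ.numVars)
  nonempty i j := by
    by_cases hj : (j : ℕ) = φ.numVars
    · exact ⟨(false, Fin.last M), by simp [hj]⟩
    · have hj : (j : ℕ) < φ.numVars := by omega
      refine ⟨(false, 0), Finset.mem_filter.2 ⟨Finset.mem_univ _, ?_⟩⟩
      refine (if_pos hM).trans ((if_pos hj).trans ?_)
      exact allows_restrict (p i) (fun _ => false) φ.numVars j

section

variable {φ : ThreeCNF} {x M : ℕ} {p : Fin x → ℕ → Bool} {hx : 0 < x} {hM : 0 < M}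

theorem mem_tiling_S {i : Fin x} {j : Fin (φ.numVars + 1)} {a : Bool} {v : Fin (M + 1)} :
    (a, v) ∈ (tiling φ p hx hM).S i j ↔ if (v : ℕ) < M then
      columnBit φ.clauses j a (next^[v] (restrict (p i) (fun _ => false) φ.numVars))
      else decide ((j : ℕ) = φ.numVars) :=
  Finset.mem_filter.trans (and_iff_right (Finset.mem_univ _))

theorem encode_tiling : (tiling φ p hx hM).encode =
    List.replicate x true ++ [false] ++ List.replicate (φ.numVars + 1) true ++ [false] ++
      List.replicate (M + 1) true ++ [false] ++
      (List.ofFn p).flatMap fun q => rowBits φ.clauses q M := by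
  refine congrArg (List.append _) ?_
  rw [List.ofFn_eq_map, List.flatMap_map]
  refine List.flatMap_congr fun i _ => ?_
  rw [rowBits, ← List.map_coe_finRange_eq_range, List.flatMap_map]
  refine List.flatMap_congr fun j _ => List.flatMap_congr fun a _ => ?_
  exact map_finRange_succ fun v =>
    Bool.eq_iff_iff.2 (decide_eq_true_iff.trans mem_tiling_S)

theorem satisfiable_of_isYes_tiling (hp : ∀ j : Fin 3 → ℕ, ∃ i, ∀ m, p i (j m))
    (h : (tiling φ p hx hM).IsYes) : φ.Satisfiable := by
  obtain ⟨A, V, hAV⟩ := (NarrowGridTiling.isYes_iff _).1 h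
  refine ⟨fun j => A j.castSucc, fun c hc => ?_⟩
  obtain ⟨i, hi⟩ := hp fun m => (c m).1
  have hmem (j : Fin (φ.numVars + 1)) := mem_tiling_S.1 (hAV i j)
  have hV : (V i : ℕ) < M := by
    by_contra hV
    have h0 := hmem (c 0).1.castSucc
    rw [if_neg hV] at h0
    exact (c 0).1.isLt.ne (of_decide_eq_true h0)
  simp only [if_pos hV, columnBit] at hmem
  have hlast := hmem (Fin.last _)
  rw [Fin.val_last, if_neg (lt_irrefl _)] at hlast
  obtain ⟨m, -, hm⟩ := List.any_eq_true.1 (List.all_eq_true.1 hlast c hc)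
  have hA := hmem (c m).1.castSucc
  rw [Fin.val_castSucc, if_pos (c m).1.isLt] at hA
  refine ⟨m, eq_of_allows ?_ hA hm⟩
  rw [isSome_iterate_next, isSome_restrict _ _ (c m).1.isLt, hi m]

theorem isYes_tiling_of_satisfiable (hp : ∀ i α, ∃ v < M,
      next^[v] (restrict (p i) (fun _ => false) φ.numVars) = restrict (p i) α φ.numVars)
    (h : φ.Satisfiable) : (tiling φ p hx hM).IsYes := by
  obtain ⟨β, hβ⟩ := h
  obtain ⟨α, rfl⟩ : ∃ α : ℕ → Bool, β = fun j : Fin φ.numVars => α j :=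
    ⟨fun j => if hj : j < φ.numVars then β ⟨j, hj⟩ else false, by simp⟩
  choose V hV hVα using fun i => hp i α
  have hcell (i : Fin x) (j : ℕ) : columnBit φ.clauses j (α j)
      (next^[V i] (restrict (p i) (fun _ => false) φ.numVars)) := by
    rw [hVα, columnBit]
    split_ifs
    · exact allows_restrict _ _ _ _
    · refine List.all_eq_true.2 fun c hc => ?_
      obtain ⟨m, hm⟩ := hβ c hc
      exact List.any_eq_true.2 ⟨m, List.mem_finRange m, hm ▸ allows_restrict _ _ _ _⟩
  exact (NarrowGridTiling.isYes_iff _).2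
    ⟨fun j : Fin (φ.numVars + 1) => α j, fun i => ⟨V i, (hV i).trans M.lt_succ_self⟩,
      fun i j => mem_tiling_S.2 ((if_pos (hV i)).trans (hcell i j))⟩

end

/-! ### Rows for all triples of residue classes -/

/-- Whether the residue of `j` modulo `k` is one of the three residues that are given by the row
`i`. -/
def covers (k : ℕ) (i : Fin (k ^ 3)) (j : ℕ) : Bool :=
  decide (∃ m, (finFunctionFinEquiv.symm i m : ℕ) = j % k)

theorem periodic_covers (k : ℕ) (i : Fin (k ^ 3)) : Function.Periodic (covers k i) k := by
  intro j
  simp [covers]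

theorem exists_covers {k : ℕ} (hk : 0 < k) (j : Fin 3 → ℕ) : ∃ i, ∀ m, covers k i (j m) :=
  ⟨finFunctionFinEquiv fun m => ⟨j m % k, Nat.mod_lt _ hk⟩, fun m => decide_eq_true ⟨m, by simp⟩⟩

theorem count_mod_eq {k r : ℕ} (hr : r < k) (n : ℕ) :
    Nat.count (· % k = r) n = n / k + if r < n % k then 1 else 0 := by
  simpa only [Nat.ModEq, Nat.mod_eq_of_lt hr] using
    Nat.count_modEq_card n (Nat.zero_lt_of_lt hr) r

theorem count_mod_eq_le {k r : ℕ} (hr : r < k) (n : ℕ) :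
    Nat.count (· % k = r) n ≤ Nat.count (· % k = 0) n := by
  rw [count_mod_eq hr, count_mod_eq (Nat.zero_lt_of_lt hr)]
  split_ifs <;> omega

theorem count_exists_le {ι : Type*} [Fintype ι] (q : ι → ℕ → Prop) [∀ i, DecidablePred (q i)]
    (n : ℕ) : Nat.count (fun j => ∃ i, q i j) n ≤ ∑ i, Nat.count (q i) n := by
  simp only [Nat.count_eq_card_filter_range]
  refine (Finset.card_le_card fun j hj => ?_).trans Finset.card_biUnion_le
  simpa using hj

theorem count_covers_le (k : ℕ) (i : Fin (k ^ 3)) (n : ℕ) :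
    Nat.count (covers k i ·) n ≤ 3 * Nat.count (· % k = 0) n := by
  have hle := count_exists_le (fun m j => j % k = (finFunctionFinEquiv.symm i m : ℕ)) n
  have hsum := Finset.sum_le_card_nsmul Finset.univ _ _ fun m _ =>
    count_mod_eq_le (finFunctionFinEquiv.symm i m).isLt n
  simpa [covers, eq_comm] using hle.trans hsum

/-! ### The reduction from 3-SAT -/

theorem numAssignments_eq_two_pow (k n : ℕ) :
    numAssignments k n = 2 ^ (3 * Nat.count (· % k = 0) n) :=
  (pow_mul 2 3 _).symm

theorem numAssignments_pos (k n : ℕ) : 0 < numAssignments k n :=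
  pow_pos (by norm_num) _

/-- The tiling instance of a formula with one row for each triple of residue classes modulo `k`. It
is equivalent to the formula, as the variables of a clause always lie in three residue classes. -/
def tripleTiling (k : ℕ) (hk : 0 < k) (φ : ThreeCNF) : NarrowGridTiling :=
  tiling φ (covers k) (pow_pos hk 3) (numAssignments_pos k φ.numVars)

theorem isYes_tripleTiling_iff {k : ℕ} (hk : 0 < k) (φ : ThreeCNF) :
    (tripleTiling k hk φ).IsYes ↔ φ.Satisfiable := by
  refine ⟨satisfiable_of_isYes_tiling (exists_covers hk),
    isYes_tiling_of_satisfiable fun i α => ?_⟩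
  rw [numAssignments_eq_two_pow]
  exact exists_iterate_next_eq_restrict α (count_covers_le k i φ.numVars)

theorem solvableInTime_satisfiable {T : NarrowGridTiling → ℝ} {k : ℕ} (hk : 0 < k)
    (h : SolvableInTime NarrowGridTiling.encode NarrowGridTiling.IsYes T) :
    SolvableInTime ThreeCNF.encode ThreeCNF.Satisfiable fun φ => T (tripleTiling k hk φ) +
      (reductionTime k (k ^ 3) φ.numVars φ.clauses.length +
        (tripleTiling k hk φ).encode.length + 1 : ℕ) := by
  refine h.of_reduction (tripleTiling k hk) (isYes_tripleTiling_iff hk)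
    (reduction k (List.ofFn (covers k))) .inp .out
    (fun φ => reductionTime k (k ^ 3) φ.numVars φ.clauses.length) fun φ => ?_
  have hexec := exec_reduction φ.clauses hk (l := List.ofFn (covers k))
    (List.forall_mem_ofFn_iff.2 (periodic_covers k)) (List.forall_mem_ofFn_iff.2 fun i => by
      rw [numAssignments_eq_two_pow]
      exact iterate_next_two_pow (count_covers_le k i φ.numVars))
  rw [List.length_ofFn] at hexec
  have hinp : φ.encode = List.replicate φ.numVars true ++ false :: encodeClauses φ.clauses :=
    List.append_assoc _ [false] _
  rw [hinp, tripleTiling, encode_tiling]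
  convert (show Run _ _ _ _ from hexec) using 1 <;>
  · funext s
    cases s <;> rfl

/-! ### The running time -/

theorem NarrowGridTiling.length_encode (I : NarrowGridTiling) :
    I.encode.length = I.x + I.y + I.N + 3 + I.x * (I.y * (2 * I.N)) := by
  simp only [NarrowGridTiling.encode, List.length_append, List.length_replicate,
    List.length_flatMap, List.length_map, List.length_finRange, List.map_const',
    List.sum_replicate, smul_eq_mul, List.length_cons, List.length_nil, zero_add, Nat.reduceAdd]
  omega

theorem ThreeCNF.length_clauses_le (φ : ThreeCNF) :
    φ.clauses.length ≤ 8 * (φ.numVars + 1) ^ 3 := by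
  refine φ.nodup.length_le_card.trans ?_
  simp only [Fintype.card_fun, Fintype.card_prod, Fintype.card_fin, Fintype.card_bool]
  calc (φ.numVars * 2) ^ 3 = 8 * φ.numVars ^ 3 := by ring
    _ ≤ _ := by gcongr; omega

theorem pow_mul_pow_le {M N a b c d : ℕ} (hM : 0 < M) (hN : 0 < N) (hab : a ≤ b) (hcd : c ≤ d) :
    M ^ a * N ^ c ≤ M ^ b * N ^ d :=
  Nat.mul_le_mul (Nat.pow_le_pow_right hM hab) (Nat.pow_le_pow_right hN hcd)

theorem rowTime_le (k : ℕ) {n M m : ℕ} (hM : 0 < M) (hm : m ≤ 8 * (n + 1) ^ 3) :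
    rowTime k n M m ≤ (2 * k + 1300) * ((n + 1) ^ 5 * M) := by
  have hmono : rowTime k n M m ≤ rowTime k (n + 1) M (8 * (n + 1) ^ 3) := by
    unfold rowTime
    gcongr <;> omega
  refine hmono.trans ?_
  have hle (a e : ℕ) (ha : a ≤ 5 := by norm_num) (he : e ≤ 1 := by norm_num) :=
    pow_mul_pow_le (b := 5) (d := 1) n.succ_pos hM ha he
  unfold rowTime
  linarith [hle 0 1, hle 1 1, hle 2 1, hle 3 1, hle 4 1, hle 0 0, hle 1 0,
    Nat.mul_le_mul_left k (hle 0 0), Nat.mul_le_mul_left k (hle 1 0)]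

theorem reductionTime_le (k x : ℕ) {n m : ℕ} (hm : m ≤ 8 * (n + 1) ^ 3) :
    reductionTime k x n m ≤
      (x * (2 * k + 1301) + 2 * k + 74) * ((n + 1) ^ 5 * numAssignments k n) := by
  have hM := numAssignments_pos k n
  have hrow := rowTime_le k hM hm
  have hclauses : m * (3 * n + 3) ≤ 8 * (n + 1) ^ 3 * (3 * (n + 1)) := by
    gcongr
    omega
  unfold reductionTime
  generalize numAssignments k n = M at *
  have hle (a e : ℕ) (ha : a ≤ 5 := by norm_num) (he : e ≤ 1 := by norm_num) :=
    pow_mul_pow_le (b := 5) (d := 1) n.succ_pos hM ha he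
  linarith [Nat.mul_le_mul_left x hrow, Nat.mul_le_mul_left x (hle 0 0), hle 4 0, hle 1 1, hle 1 0,
    Nat.mul_le_mul_left k (hle 0 0), Nat.mul_le_mul_left k (hle 1 0)]

theorem length_encode_tripleTiling_le (k : ℕ) (hk : 0 < k) (φ : ThreeCNF) :
    (tripleTiling k hk φ).encode.length ≤
      (5 * k ^ 3 + 6) * ((φ.numVars + 1) ^ 5 * numAssignments k φ.numVars) := by
  rw [NarrowGridTiling.length_encode]
  change k ^ 3 + (φ.numVars + 1) + (numAssignments k φ.numVars + 1) + 3 +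
    k ^ 3 * ((φ.numVars + 1) * (2 * (numAssignments k φ.numVars + 1))) ≤ _
  have hM := numAssignments_pos k φ.numVars
  generalize numAssignments k φ.numVars = M at *
  have hle (a e : ℕ) (ha : a ≤ 5 := by norm_num) (he : e ≤ 1 := by norm_num) :=
    pow_mul_pow_le (b := 5) (d := 1) φ.numVars.succ_pos hM ha he
  linarith [hle 0 1, hle 0 0, hle 1 0, Nat.mul_le_mul_left (k ^ 3) (hle 1 1),
    Nat.mul_le_mul_left (k ^ 3) (hle 0 0), Nat.mul_le_mul_left (k ^ 3) (hle 1 0)]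

theorem numAssignments_le {k : ℕ} (hk : 0 < k) (n : ℕ) :
    (numAssignments k n : ℝ) ≤ 8 * (2 : ℝ) ^ (3 / k * n : ℝ) := by
  have hcount : (Nat.count (· % k = 0) n : ℝ) ≤ n / k + 1 := by
    have : Nat.count (· % k = 0) n ≤ n / k + 1 := by
      rw [count_mod_eq hk]
      split_ifs <;> omega
    exact (Nat.cast_le.2 this).trans (by push_cast; gcongr; exact Nat.cast_div_le)
  calc (numAssignments k n : ℝ) = (2 : ℝ) ^ (3 * Nat.count (· % k = 0) n : ℝ) := by
        rw [numAssignments_eq_two_pow]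
        exact_mod_cast rfl
    _ ≤ (2 : ℝ) ^ (3 * ((n : ℝ) / k + 1)) := by gcongr; exact one_le_two
    _ = (2 : ℝ) ^ (3 / k * n : ℝ) * (2 : ℝ) ^ (3 : ℝ) := by
        rw [← Real.rpow_add two_pos]
        ring_nf
    _ = _ := by norm_num [mul_comm]

theorem logb_numAssignments_succ_le (k n : ℕ) :
    Real.logb 2 (numAssignments k n + 1 : ℕ) ≤ 3 * (n + 1) := by
  have hle : numAssignments k n + 1 ≤ 2 ^ (3 * (n + 1)) := by
    have hcount : Nat.count (· % k = 0) n ≤ n := Nat.count_le _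
    calc numAssignments k n + 1 ≤ 2 ^ (3 * n) + 2 ^ (3 * n) := by
          rw [numAssignments_eq_two_pow]
          gcongr
          exacts [one_le_two, Nat.one_le_two_pow]
      _ = 2 ^ (3 * n + 1) := by ring
      _ ≤ _ := by gcongr <;> omega
  calc Real.logb 2 (numAssignments k n + 1 : ℕ) ≤ Real.logb 2 ((2 : ℝ) ^ (3 * (n + 1))) :=
        Real.logb_le_logb_of_le one_lt_two (by positivity) (by exact_mod_cast hle)
    _ = 3 * (n + 1) := by
        rw [Real.logb_pow, Real.logb_self_eq_one one_lt_two]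
        push_cast
        ring

theorem exists_pow_le_two_rpow (d : ℕ) {η : ℝ} (hη : 0 < η) :
    ∃ C : ℝ, ∀ n : ℕ, ((n : ℝ) + 1) ^ d ≤ C * (2 : ℝ) ^ (η * n) := by
  have hO := (isLittleO_pow_const_const_pow_of_one_lt (R := ℝ) d
    (Real.one_lt_rpow one_lt_two hη)).isBigO
  obtain ⟨C, -, hC⟩ := Asymptotics.bound_of_isBigO_nat_atTop hO
  refine ⟨C * 2 ^ η, fun n => ?_⟩
  have hn := hC (x := n + 1) (by positivity)
  rw [Real.norm_of_nonneg (by positivity), Real.norm_of_nonneg (by positivity), pow_succ',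
    ← Real.rpow_mul_natCast zero_le_two] at hn
  push_cast at hn
  linarith

theorem exists_reductionTime_le {k : ℕ} (hk : 0 < k) {δ : ℝ} (hδ : 3 / k < δ) :
    ∃ C : ℝ, ∀ φ : ThreeCNF, ((reductionTime k (k ^ 3) φ.numVars φ.clauses.length +
      (tripleTiling k hk φ).encode.length + 1 : ℕ) : ℝ) ≤ C * (2 : ℝ) ^ (δ * φ.numVars) := by
  obtain ⟨C, hC⟩ := exists_pow_le_two_rpow 5 (sub_pos.2 hδ)
  obtain ⟨c, hc⟩ : ∃ c, c = k ^ 3 * (2 * k + 1301) + 2 * k + 74 + (5 * k ^ 3 + 6) + 1 := ⟨_, rfl⟩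
  refine ⟨c * (C * 8), fun φ => ?_⟩
  have hone : 1 ≤ (φ.numVars + 1) ^ 5 * numAssignments k φ.numVars :=
    Nat.mul_pos (by positivity) (numAssignments_pos k _)
  have htime := reductionTime_le k (k ^ 3) φ.length_clauses_le
  have hlength := length_encode_tripleTiling_le k hk φ
  calc _ ≤ ((c * ((φ.numVars + 1) ^ 5 * numAssignments k φ.numVars) : ℕ) : ℝ) := by
        rw [hc, add_mul, add_mul _ (5 * k ^ 3 + 6), one_mul]
        exact_mod_cast add_le_add (add_le_add htime hlength) hone
    _ = c * (((φ.numVars : ℝ) + 1) ^ 5 * numAssignments k φ.numVars) := by push_cast; rfl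
    _ ≤ c * (C * (2 : ℝ) ^ ((δ - 3 / k) * φ.numVars) *
          (8 * (2 : ℝ) ^ (3 / k * φ.numVars : ℝ))) := by
        gcongr
        · exact (by positivity : (0 : ℝ) ≤ _).trans (hC _)
        · exact hC _
        · exact numAssignments_le hk _
    _ = c * (C * 8) * (2 : ℝ) ^ (δ * φ.numVars) := by
        rw [sub_mul, Real.rpow_sub two_pos]
        field_simp

theorem exists_tilingTime_le {k : ℕ} (hk : 0 < k) {b δ x : ℝ} (hb : 0 ≤ b) (hδ : 3 / k * b < δ)
    (hx : 0 < x) : ∃ ε : ℝ, 0 < ε ∧ ∀ C : ℝ, 0 < C → ∃ C' : ℝ, ∀ n : ℕ,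
      C * (2 : ℝ) ^ (ε * (x * (n + 1 : ℕ) + x ^ 2 * Real.logb 2 (numAssignments k n + 1 : ℕ))) *
        ((numAssignments k n + 1 : ℕ) : ℝ) ^ b ≤ C' * (2 : ℝ) ^ (δ * n) := by
  have hη := sub_pos.2 hδ
  refine ⟨(δ - 3 / k * b) / (x + 3 * x ^ 2), div_pos hη (by positivity), fun C hC =>
    ⟨C * 2 ^ (δ - 3 / k * b) * 16 ^ b, fun n => ?_⟩⟩
  have hN : ((numAssignments k n + 1 : ℕ) : ℝ) ≤ 16 * (2 : ℝ) ^ (3 / k * n : ℝ) := by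
    have hone : (1 : ℝ) ≤ numAssignments k n := by exact_mod_cast numAssignments_pos k n
    push_cast
    linarith [numAssignments_le hk n]
  have hexp : (δ - 3 / k * b) / (x + 3 * x ^ 2) *
      (x * (n + 1 : ℕ) + x ^ 2 * Real.logb 2 (numAssignments k n + 1 : ℕ)) ≤
        (δ - 3 / k * b) * (n + 1) := by
    calc _ ≤ (δ - 3 / k * b) / (x + 3 * x ^ 2) * (x * (n + 1 : ℕ) + x ^ 2 * (3 * (n + 1))) := by
          gcongr
          exact logb_numAssignments_succ_le k n
      _ = _ := by
          push_cast
          field_simp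
  calc _ ≤ C * (2 : ℝ) ^ ((δ - 3 / k * b) * (n + 1)) * (16 * (2 : ℝ) ^ (3 / k * n : ℝ)) ^ b := by
        gcongr
        exact one_le_two
    _ = C * (2 ^ (δ - 3 / k * b) * (2 : ℝ) ^ ((δ - 3 / k * b) * n)) *
          (16 ^ b * (2 : ℝ) ^ (3 / k * b * n : ℝ)) := by
        rw [Real.mul_rpow (by norm_num) (by positivity), ← Real.rpow_mul zero_le_two, mul_add_one,
          Real.rpow_add two_pos, mul_right_comm _ (n : ℝ)]
        ring
    _ = C * 2 ^ (δ - 3 / k * b) * 16 ^ b * (2 : ℝ) ^ (δ * n) := by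
        rw [show δ * n = (δ - 3 / k * b) * n + 3 / k * b * n by ring, Real.rpow_add two_pos]
        ring

theorem ExponentialTimeHypothesis.exists_not_solvableInTime (hETH : ExponentialTimeHypothesis)
    {b : ℝ} (hb : 0 ≤ b) :
    ∃ ε : ℝ, 0 < ε ∧ ∀ C : ℝ, 0 < C →
      ¬ SolvableInTime NarrowGridTiling.encode NarrowGridTiling.IsYes fun I =>
          C * (2 : ℝ) ^ (ε * ((I.x : ℝ) * (I.y : ℝ) + (I.x : ℝ) ^ 2 * Real.logb 2 (I.N : ℝ))) *
            (I.N : ℝ) ^ b := by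
  obtain ⟨δ, hδ, hETH⟩ := hETH
  obtain ⟨k, hkδ⟩ := exists_nat_gt (3 * (b + 1) / δ)
  have hk : 0 < (k : ℝ) := lt_of_le_of_lt (by positivity) hkδ
  have hδ' : 3 / k * (b + 1) < δ := by
    rwa [div_mul_eq_mul_div, div_lt_comm₀ hk hδ]
  have hδ₁ : 3 / k < δ := (le_mul_of_one_le_right (by positivity) (by linarith)).trans_lt hδ'
  have hδ₂ : 3 / k * b < δ := (mul_le_mul_of_nonneg_left (by linarith) (by positivity)).trans_lt hδ'
  rw [Nat.cast_pos] at hk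
  obtain ⟨ε, hε, htiling⟩ := exists_tilingTime_le hk hb hδ₂ (x := (k ^ 3 : ℕ)) (by positivity)
  obtain ⟨C₂, hC₂⟩ := exists_reductionTime_le hk hδ₁
  refine ⟨ε, hε, fun C hC hsolv => ?_⟩
  obtain ⟨C₁, hC₁⟩ := htiling C hC
  refine hETH ⟨C₁ + C₂, (solvableInTime_satisfiable hk hsolv).mono fun φ => ?_⟩
  rw [add_mul]
  exact add_le_add (hC₁ φ.numVars) (hC₂ φ)

theorem exists_two_rpow_le_of_isLittleO {f : ℕ → ℝ}
    (hf : f =o[Filter.atTop] fun s : ℕ => (s : ℝ)) {ε : ℝ} (hε : 0 < ε) :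
    ∃ C : ℝ, 0 < C ∧ ∀ s : ℕ, (2 : ℝ) ^ f s ≤ C * (2 : ℝ) ^ (ε * s) := by
  have hO : (fun s : ℕ => (2 : ℝ) ^ f s) =O[Filter.atTop] fun s : ℕ => (2 : ℝ) ^ (ε * s) := by
    refine Asymptotics.IsBigO.of_bound 1 ?_
    filter_upwards [hf.bound hε] with s hs
    rw [Real.norm_of_nonneg (by positivity), Real.norm_of_nonneg (by positivity), one_mul]
    rw [Real.norm_natCast] at hs
    exact Real.rpow_le_rpow_of_exponent_le one_le_two ((Real.le_norm_self _).trans hs)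
  obtain ⟨C, hC, hle⟩ := Asymptotics.bound_of_isBigO_nat_atTop hO
  refine ⟨C, hC, fun s => ?_⟩
  have hs := hle (x := s) (by positivity)
  rwa [Real.norm_of_nonneg (by positivity), Real.norm_of_nonneg (by positivity)] at hs

theorem NarrowGridTiling.one_le_N (I : NarrowGridTiling) : 1 ≤ I.N :=
  let ⟨p, _⟩ := I.nonempty ⟨0, I.x_pos⟩ ⟨0, I.y_pos⟩
  p.2.pos

theorem mainTheorem10 (hETH : ExponentialTimeHypothesis) :
    (∀ b : ℝ, 0 < b → ∃ ε : ℝ, 0 < ε ∧ ∀ C : ℝ, 0 < C →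
      ¬ SolvableInTime NarrowGridTiling.encode NarrowGridTiling.IsYes fun I =>
          C * (2 : ℝ) ^ (ε * ((I.x : ℝ) * (I.y : ℝ) + (I.x : ℝ) ^ 2 * Real.logb 2 (I.N : ℝ))) *
            (I.N : ℝ) ^ b) ∧
    (∀ (f : ℕ → ℝ) (b : ℝ),
      Asymptotics.IsLittleO Filter.atTop f (fun s : ℕ => (s : ℝ)) →
      ¬ SolvableInTime NarrowGridTiling.encode NarrowGridTiling.IsYes fun I =>
          (2 : ℝ) ^ f (I.x * I.y) * (I.N : ℝ) ^ b) := by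
  refine ⟨fun b hb => hETH.exists_not_solvableInTime hb.le, fun f b hf hsolv => ?_⟩
  obtain ⟨ε, hε, hlower⟩ := hETH.exists_not_solvableInTime (le_max_right b 0)
  obtain ⟨C, hC, hfC⟩ := exists_two_rpow_le_of_isLittleO hf hε
  refine hlower C hC (hsolv.mono fun I => ?_)
  have hN : (1 : ℝ) ≤ I.N := by exact_mod_cast I.one_le_N
  have hlog : 0 ≤ Real.logb 2 I.N := Real.logb_nonneg one_lt_two hN
  calc (2 : ℝ) ^ f (I.x * I.y) * (I.N : ℝ) ^ b
      ≤ C * (2 : ℝ) ^ (ε * (I.x * I.y : ℕ)) * (I.N : ℝ) ^ max b 0 := by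
        gcongr
        exacts [hfC _, le_max_left b 0]
    _ ≤ _ := by
        push_cast
        gcongr
        exacts [one_le_two, le_add_of_nonneg_right (by positivity)]
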